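/- Let $K$ be a field and let $A=K[X_1,\dots,X_n]$ be the standard graded polynomial ring with homogeneous maximal ideal $\mathfrak m=(X_1,\dots,X_n)$. Let $F=\bigoplus_{j=1}^m A e_j$ be a graded free $A$-module with basis elements $e_j$ of degrees $d_j\in\mathbb Z$, and fix weights $\omega\in\mathbb Z_{\ge 0}^n$ and $\epsilon\in\mathbb Z_{\ge 0}^m$. The weight of a monomial $X^{u}e_j$ is $\omega\cdot u+\epsilon_j$. For $0\neq f\in F$ let $\operatorname{in}_{(\omega,\epsilon)}(f)$ be the sum (with coefficients) of all monomials of largest weight occurring in $f$, and for a submodule $M\subseteq F$ let $\operatorname{in}_{(\omega,\epsilon)}(M)$ be the submodule of $F$ generated by all $\operatorname{in}_{(\omega,\epsilon)}(f)$ with $0\ne f\in M$. For a finitely generated graded $A$-module $N$ with minimal graded free resolution $\cdots\to F_1\xrightarrow{\partial_1}F_0\xrightarrow{\partial_0}N\to 0$, let $\beta_i(N)$ be the rank of $F_i$, let $\operatorname{reg}(N)$ be the least $r$ such that, for all $i\geq 0$, $F_i$ is generated in degrees at most $r+i$ (with $\operatorname{reg}(0)=-\infty$), and put $\Omega_j(N)=\ker(\partial_j)$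 for $j\ge 0$ and $\Omega_j(N)=N$ for $j<0$; thus $\Omega_0(N)=\ker(F_0\to N)$. The module $N$ is called componentwise linear if for every $a\in\mathbb Z$ the submodule $N_{\langle a\rangle}$ of $N$ generated by the homogeneous elements of degree $a$ satisfies $\operatorname{reg}(N_{\langle a\rangle})\le a$. Let $M\subseteq F$ be a graded submodule such that $\operatorname{in}_{(\omega,\epsilon)}(M)$ is componentwise linear. If $\beta_i(M)=\beta_i(\operatorname{in}_{(\omega,\epsilon)}(M))$ for some integer $i\ge 0$, then $\Omega_j(M)$ is componentwise linear for every integer $j\ge i-2$. -/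

import Mathlib

namespace GradedFree

open MvPolynomial

/-! Throughout, `A = K[X₁, …, Xₙ]` is `MvPolynomial (Fin n) K` with its standard grading, and the
graded free module `F = ⨁ⱼ A(-dⱼ)` is `Fin m → A` together with the degrees `d : Fin m → ℤ` of its
standard basis. -/

section

variable {K : Type*} [Field K] {n m : ℕ}

/-- `f ∈ ⨁ⱼ A(-dⱼ)` is homogeneous of degree `k`: every monomial `X^u eⱼ` occurring in `f`
has degree `|u| + dⱼ = k`. -/
def IsHomogeneous (d : Fin m → ℤ) (k : ℤ) (f : Fin m → MvPolynomial (Fin n) K) : Prop :=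
  ∀ j, ∀ u ∈ (f j).support, ((Finsupp.degree u : ℕ) : ℤ) + d j = k

/-- A submodule of `⨁ⱼ A(-dⱼ)` is graded if it is generated by its homogeneous elements. -/
def IsGraded (d : Fin m → ℤ)
    (N : Submodule (MvPolynomial (Fin n) K) (Fin m → MvPolynomial (Fin n) K)) : Prop :=
  Submodule.span (MvPolynomial (Fin n) K) {f | f ∈ N ∧ ∃ k, IsHomogeneous d k f} = N

/-- `N_{⟨a⟩}`: the submodule of `N` generated by its homogeneous elements of degree `a`. -/
noncomputable def component (d : Fin m → ℤ) (a : ℤ)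
    (N : Submodule (MvPolynomial (Fin n) K) (Fin m → MvPolynomial (Fin n) K)) :
    Submodule (MvPolynomial (Fin n) K) (Fin m → MvPolynomial (Fin n) K) :=
  Submodule.span (MvPolynomial (Fin n) K) {f | f ∈ N ∧ IsHomogeneous d a f}

/-- The largest weight `ω · u + εⱼ` of a monomial `X^u eⱼ` occurring in `f` (and `0` if `f = 0`). -/
def topWeight (ω : Fin n → ℕ) (ε : Fin m → ℕ) (f : Fin m → MvPolynomial (Fin n) K) : ℕ :=
  Finset.univ.sup fun j => (f j).support.sup fun u => (∑ i, ω i * u i) + ε j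

/-- The initial part of `f`: the sum, with coefficients, of all monomials of largest weight
occurring in `f`. -/
noncomputable def initialPart (ω : Fin n → ℕ) (ε : Fin m → ℕ)
    (f : Fin m → MvPolynomial (Fin n) K) : Fin m → MvPolynomial (Fin n) K :=
  fun j => ∑ u ∈ (f j).support with (∑ i, ω i * u i) + ε j = topWeight ω ε f,
    monomial u (coeff u (f j))

/-- The initial module: the submodule generated by the initial parts of the elements of `N`. -/
noncomputable def initialModule (ω : Fin n → ℕ) (ε : Fin m → ℕ)
    (N : Submodule (MvPolynomial (Fin n) K) (Fin m → MvPolynomial (Fin n) K)) :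
    Submodule (MvPolynomial (Fin n) K) (Fin m → MvPolynomial (Fin n) K) :=
  Submodule.span (MvPolynomial (Fin n) K) {g | ∃ f ∈ N, f ≠ 0 ∧ initialPart ω ε f = g}

end

/-- The homogeneous maximal ideal `(X₁, …, Xₙ)` of `K[X₁, …, Xₙ]`. -/
noncomputable def maxIdeal (K : Type*) [Field K] (n : ℕ) : Ideal (MvPolynomial (Fin n) K) :=
  Ideal.span (Set.range X)

section

variable {K : Type*} [Field K] {n m : ℕ}

/-- A minimal graded free resolution `⋯ → F₂ → F₁ → F₀ → N → 0` of a submodule `N` of the graded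
free module `⨁ⱼ A(-dⱼ)`, by finitely generated graded free modules
`Fᵢ = ⨁ₗ A(-deg i l)`, `l < rank i`. -/
structure MinimalResolution (d : Fin m → ℤ)
    (N : Submodule (MvPolynomial (Fin n) K) (Fin m → MvPolynomial (Fin n) K)) where
  /-- the rank of `Fᵢ` -/
  rank : ℕ → ℕ
  /-- the degrees of the basis elements of `Fᵢ` -/
  deg : (i : ℕ) → Fin (rank i) → ℤ
  /-- the augmentation `F₀ → N`, composed with the inclusion of `N` -/
  aug : (Fin (rank 0) → MvPolynomial (Fin n) K) →ₗ[MvPolynomial (Fin n) K]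
    (Fin m → MvPolynomial (Fin n) K)
  /-- the differential `Fᵢ₊₁ → Fᵢ` -/
  diff : (i : ℕ) → (Fin (rank (i + 1)) → MvPolynomial (Fin n) K) →ₗ[MvPolynomial (Fin n) K]
    (Fin (rank i) → MvPolynomial (Fin n) K)
  aug_homogeneous : ∀ k x, IsHomogeneous (deg 0) k x → IsHomogeneous d k (aug x)
  diff_homogeneous : ∀ i k x,
    IsHomogeneous (deg (i + 1)) k x → IsHomogeneous (deg i) k (diff i x)
  range_aug : LinearMap.range aug = N
  exact_zero : LinearMap.range (diff 0) = LinearMap.ker aug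
  exact_succ : ∀ i, LinearMap.range (diff (i + 1)) = LinearMap.ker (diff i)
  minimal : ∀ i, LinearMap.range (diff i) ≤ maxIdeal K n • ⊤

/-- The `i`-th (total) Betti number of `N`: the rank of the `i`-th module of a minimal graded free
resolution of `N`. -/
noncomputable def betti (d : Fin m → ℤ)
    (N : Submodule (MvPolynomial (Fin n) K) (Fin m → MvPolynomial (Fin n) K)) (i : ℕ) : ℕ :=
  sInf {b | ∃ P : MinimalResolution d N, P.rank i = b}

/-- `reg N ≤ r`: in a minimal graded free resolution of `N`, the generators of the `i`-th free
module have degree at most `r + i`, for all `i`. -/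
def RegularityLE (d : Fin m → ℤ)
    (N : Submodule (MvPolynomial (Fin n) K) (Fin m → MvPolynomial (Fin n) K)) (r : ℤ) : Prop :=
  ∃ P : MinimalResolution d N, ∀ i l, P.deg i l ≤ r + i

/-- `N` is `r`-componentwise regular: `reg N_{⟨a⟩} ≤ a + r` for all `a`. -/
def ComponentwiseRegular (d : Fin m → ℤ)
    (N : Submodule (MvPolynomial (Fin n) K) (Fin m → MvPolynomial (Fin n) K)) (r : ℤ) : Prop :=
  ∀ a : ℤ, RegularityLE d (component d a N) (a + r)

/-- `N` is componentwise linear: `reg N_{⟨a⟩} ≤ a` for all `a`. -/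
def ComponentwiseLinear (d : Fin m → ℤ)
    (N : Submodule (MvPolynomial (Fin n) K) (Fin m → MvPolynomial (Fin n) K)) : Prop :=
  ComponentwiseRegular d N 0

end

/-- A submodule of a graded free module, bundled with the ambient free module. -/
structure SubmoduleOfFree (K : Type*) [Field K] (n : ℕ) where
  /-- the rank of the ambient free module -/
  rank : ℕ
  /-- the degrees of the basis of the ambient free module -/
  deg : Fin rank → ℤ
  /-- the submodule -/
  carrier : Submodule (MvPolynomial (Fin n) K) (Fin rank → MvPolynomial (Fin n) K)

/-- The `j`-th syzygy module `Ω_j(N) = ker (F_j → F_{j-1})` read off from a minimal graded free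
resolution of `N`, where `F_{-1} = N`, and `Ω_j(N) = N` for `j < 0`. So `Ω_0(N)` is the kernel of
the augmentation `F_0 → N`. -/
noncomputable def MinimalResolution.syzygy {K : Type*} [Field K] {n m : ℕ} {d : Fin m → ℤ}
    {N : Submodule (MvPolynomial (Fin n) K) (Fin m → MvPolynomial (Fin n) K)}
    (P : MinimalResolution d N) : ℤ → SubmoduleOfFree K n
  | Int.ofNat 0 => ⟨P.rank 0, P.deg 0, LinearMap.ker P.aug⟩
  | Int.ofNat (j + 1) => ⟨P.rank (j + 1), P.deg (j + 1), LinearMap.ker (P.diff j)⟩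
  | Int.negSucc _ => ⟨m, d, N⟩

end GradedFree

/-! Regularity can be read off from Koszul homology. For a graded submodule N of a free module, reg
N ≤ r holds exactly when, for every i, the Koszul homology of N in homological degree i vanishes in
internal degrees above r + i (`koszulRegular_of_minimalResolution`,
`regularityLE_of_koszulRegular`). In this form regularity refers to no resolution and can be
compared along the degeneration from N to in(N).

The degeneration is controlled by a `LiftedCover`. Minimal generators of in(M), homogeneous for
degree and weight, are lifted to elements of M. The resulting map G → M agrees with the minimal
cover G → in(M) up to terms of smaller weight, so it is onto M, and the initial module of its kernel
is the kernel of the cover of in(M) (`LiftedCover.initialModule_ker`). Iteration gives a graded free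
resolution of M with ranks β_k(in(M)), usually not minimal. The minimal resolution of M is a retract
of it, compatibly with syzygies (`exists_retraction_lift`).

Suppose that in(N) is componentwise linear and that the lifted cover of N is minimal. Then leading
forms of elements of 𝔪N_q lie in 𝔪 in(N)_q. Together with the vanishing of first Koszul homology
this identifies the leading forms of N_{⟨a⟩} with in(N)_{⟨a⟩}, and the vanishing of Koszul homology
passes from in(N)_{⟨a⟩} to N_{⟨a⟩} by descent on the weight
(`ComponentwiseLinear.of_initialModule`). Hence N is componentwise linear.

If β_i(M) = β_i(in(M)), the retraction at stage i is one between free modules of equal rank, hence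
an isomorphism. For i = 0 the lifted cover of M is then minimal. For i ≥ 1 the kernel of the cover
at stage i - 1 is the image of ∂_i(F_i), which lies in 𝔪F_{i-1}, so that cover is minimal and the
module it covers is componentwise linear. Its retract Ω_{i-2}(M) is then componentwise linear too,
and `ComponentwiseLinear.ker` carries the property to all later syzygies. -/

namespace GradedFree

open MvPolynomial

/-- The polynomial ring `K[X₁, …, Xₙ]`. -/
abbrev Poly (K : Type*) [Field K] (n : ℕ) := MvPolynomial (Fin n) K

/-! ### Components with respect to an arbitrary weight; degree and weight are both instances. -/

section Components

variable {K : Type*} [Field K] {n m r : ℕ}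

/-- Induction principle for the additive properties of elements of a module over a polynomial ring
that are stable under constants and variables. -/
theorem smul_induction {T : Type*} [AddCommGroup T] [Module (Poly K n) T] {P : T → Prop}
    (hadd : ∀ x y, P x → P y → P (x + y)) (hC : ∀ (a : K) x, P x → P ((C a : Poly K n) • x))
    (hX : ∀ i x, P x → P ((X i : Poly K n) • x)) (p : Poly K n) (x : T) (hx : P x) :
    P (p • x) := by
  induction p using MvPolynomial.induction_on generalizing x with
  | C a => exact hC a x hx
  | add p q hp hq => rw [add_smul]; exact hadd _ _ (hp x hx) (hq x hx)
  | mul_X p i hp => rw [mul_smul]; exact hp _ (hX i x hx)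

theorem span_poly_induction {T : Type*} [AddCommGroup T] [Module (Poly K n) T] {P : T → Prop}
    {s : Set T} (hs : ∀ x ∈ s, P x) (h0 : P 0)
    (hadd : ∀ x y, P x → P y → P (x + y)) (hC : ∀ (a : K) x, P x → P ((C a : Poly K n) • x))
    (hX : ∀ i x, P x → P ((X i : Poly K n) • x)) (x : T) (hx : x ∈ Submodule.span (Poly K n) s) :
    P x := by
  induction hx using Submodule.span_induction with
  | mem x hx => exact hs x hx
  | zero => exact h0
  | add x y _ _ hx hy => exact hadd x y hx hy
  | smul p x _ hx => exact smul_induction hadd hC hX p x hx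

theorem span_range_single :
    Submodule.span (Poly K n)
      (Set.range fun l : Fin r => (Pi.single l 1 : Fin r → Poly K n)) = ⊤ := by
  rw [eq_top_iff]
  intro g _
  rw [pi_eq_sum_univ' g]
  exact Submodule.sum_mem _ fun l _ => Submodule.smul_mem _ _ (Submodule.subset_span ⟨l, rfl⟩)

theorem free_induction {P : (Fin r → Poly K n) → Prop}
    (hs : ∀ l, P (Pi.single l 1)) (h0 : P 0)
    (hadd : ∀ x y, P x → P y → P (x + y)) (hC : ∀ (a : K) x, P x → P ((C a : Poly K n) • x))
    (hX : ∀ i x, P x → P ((X i : Poly K n) • x)) (x : Fin r → Poly K n) : P x :=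
  span_poly_induction (s := Set.range fun l => Pi.single l 1)
    (by rintro _ ⟨l, rfl⟩; exact hs l) h0 hadd hC hX x (by rw [span_range_single]; trivial)

/-- The weight `c · u + eⱼ` of the monomial `X^u eⱼ`. -/
def wt (c : Fin n → ℕ) (e : Fin m → ℤ) (j : Fin m) (u : Fin n →₀ ℕ) : ℤ :=
  ((∑ i, c i * u i : ℕ) : ℤ) + e j

/-- The component of weight `k` of an element of a free module. -/
noncomputable def wcomp (c : Fin n → ℕ) (e : Fin m → ℤ) (k : ℤ) :
    (Fin m → Poly K n) →ₗ[K] (Fin m → Poly K n) :=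
  LinearMap.pi fun j =>
    (weightedHomogeneousComponent (fun i => (c i : ℤ)) (k - e j)).comp (LinearMap.proj j)

theorem coeff_wcomp (c : Fin n → ℕ) (e : Fin m → ℤ) (k : ℤ) (f : Fin m → Poly K n) (j : Fin m)
    (u : Fin n →₀ ℕ) :
    coeff u (wcomp c e k f j) = if wt c e j u = k then coeff u (f j) else 0 := by
  simp only [wcomp, LinearMap.pi_apply, LinearMap.comp_apply, LinearMap.proj_apply,
    coeff_weightedHomogeneousComponent]
  congr 1
  rw [wt, Finsupp.weight_apply, Finsupp.sum_fintype _ _ (by simp), eq_sub_iff_add_eq]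
  push_cast
  simp [mul_comm]

theorem ext_coeff {f g : Fin m → Poly K n} (h : ∀ j u, coeff u (f j) = coeff u (g j)) : f = g :=
  funext fun j => MvPolynomial.ext _ _ (h j)

theorem wt_add_single (c : Fin n → ℕ) (e : Fin m → ℤ) (j : Fin m) (u : Fin n →₀ ℕ) (i : Fin n) :
    wt c e j (u + Finsupp.single i 1) = wt c e j u + c i := by
  simp [wt, mul_add, Finset.sum_add_distrib, Finsupp.single_apply]
  ring

theorem wcomp_wcomp (c c' : Fin n → ℕ) (e e' : Fin m → ℤ) (k k' : ℤ) (f : Fin m → Poly K n) :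
    wcomp c e k (wcomp c' e' k' f) = wcomp c' e' k' (wcomp c e k f) := by
  refine ext_coeff fun j u => ?_
  simp only [coeff_wcomp]
  split_ifs <;> rfl

theorem wcomp_idem (c : Fin n → ℕ) (e : Fin m → ℤ) (k k' : ℤ) (f : Fin m → Poly K n) :
    wcomp c e k (wcomp c e k' f) = if k = k' then wcomp c e k f else 0 := by
  refine ext_coeff fun j u => ?_
  split_ifs with h
  · subst h; simp only [coeff_wcomp]; split_ifs <;> rfl
  · simp only [coeff_wcomp]
    split_ifs with h1 h2
    · exact absurd (h1.symm.trans h2) h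
    · simp
    · simp

theorem wcomp_self (c : Fin n → ℕ) (e : Fin m → ℤ) (k : ℤ) (f : Fin m → Poly K n) :
    wcomp c e k (wcomp c e k f) = wcomp c e k f := by
  rw [wcomp_idem, if_pos rfl]

theorem wcomp_of_ne {c : Fin n → ℕ} {e : Fin m → ℤ} {k k' : ℤ} {f : Fin m → Poly K n}
    (hf : wcomp c e k f = f) (h : k' ≠ k) : wcomp c e k' f = 0 := by
  rw [← hf, wcomp_idem, if_neg h]

theorem eq_zero_of_wcomp {c : Fin n → ℕ} {e : Fin m → ℤ} {f : Fin m → Poly K n}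
    (h : ∀ k, wcomp c e k f = 0) : f = 0 := by
  refine ext_coeff fun j u => ?_
  have := coeff_wcomp c e (wt c e j u) f j u
  rw [h, if_pos rfl] at this
  exact this.symm

theorem wcomp_C_smul (c : Fin n → ℕ) (e : Fin m → ℤ) (k : ℤ) (a : K) (f : Fin m → Poly K n) :
    wcomp c e k ((C a : Poly K n) • f) = (C a : Poly K n) • wcomp c e k f := by
  have h : ∀ g : Fin m → Poly K n, (C a : Poly K n) • g = a • g := fun g => by
    ext1 j
    simp [MvPolynomial.smul_eq_C_mul]
  rw [h, h, map_smul]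

theorem wcomp_X_smul (c : Fin n → ℕ) (e : Fin m → ℤ) (k : ℤ) (i : Fin n) (f : Fin m → Poly K n) :
    wcomp c e k ((X i : Poly K n) • f) = (X i : Poly K n) • wcomp c e (k - c i) f := by
  refine ext_coeff fun j u => ?_
  rw [coeff_wcomp, Pi.smul_apply, smul_eq_mul, Pi.smul_apply, smul_eq_mul, coeff_X_mul',
    coeff_X_mul', coeff_wcomp]
  by_cases h : i ∈ u.support
  · have hu : u - Finsupp.single i 1 + Finsupp.single i 1 = u := by
      refine tsub_add_cancel_of_le ?_
      rw [Finsupp.single_le_iff]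
      exact Nat.one_le_iff_ne_zero.2 (Finsupp.mem_support_iff.1 h)
    have hw := wt_add_single c e j (u - Finsupp.single i 1) i
    rw [hu] at hw
    rw [if_pos h, if_pos h, hw]
    congr 1
    rw [eq_sub_iff_add_eq]
  · simp [h]

theorem exists_finset_wcomp (c : Fin n → ℕ) (e : Fin m → ℤ) (f : Fin m → Poly K n) :
    ∃ s : Finset ℤ, (∀ k, k ∉ s → wcomp c e k f = 0) ∧ f = ∑ k ∈ s, wcomp c e k f := by
  classical
  refine ⟨Finset.univ.biUnion fun j => (f j).support.image (wt c e j), fun k hk => ?_, ?_⟩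
  · refine ext_coeff fun j u => ?_
    rw [coeff_wcomp]
    split_ifs with h
    · by_contra h0
      refine hk (Finset.mem_biUnion.2 ⟨j, Finset.mem_univ _, Finset.mem_image.2 ⟨u, ?_, h⟩⟩)
      exact mem_support_iff.2 h0
    · rfl
  · refine ext_coeff fun j u => ?_
    rw [Finset.sum_apply, coeff_sum]
    simp only [coeff_wcomp]
    rw [Finset.sum_ite_eq]
    split_ifs with h
    · rfl
    · by_contra h0
      refine h (Finset.mem_biUnion.2 ⟨j, Finset.mem_univ _, Finset.mem_image.2 ⟨u, ?_, rfl⟩⟩)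
      exact mem_support_iff.2 h0

theorem mem_of_wcomp_mem {c : Fin n → ℕ} {e : Fin m → ℤ} {f : Fin m → Poly K n}
    {S : Type*} [SetLike S (Fin m → Poly K n)] [AddSubmonoidClass S (Fin m → Poly K n)] {N : S}
    (h : ∀ k, wcomp c e k f ∈ N) : f ∈ N := by
  obtain ⟨s, -, hs⟩ := exists_finset_wcomp c e f
  rw [hs]
  exact sum_mem fun k _ => h k

/-- All monomials occurring in `f` have weight at most `w`. -/
def WeightLE (c : Fin n → ℕ) (e : Fin m → ℤ) (w : ℤ) (f : Fin m → Poly K n) : Prop :=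
  ∀ k, w < k → wcomp c e k f = 0

namespace WeightLE

variable {c : Fin n → ℕ} {e : Fin m → ℤ} {w w' : ℤ} {f g : Fin m → Poly K n}

theorem zero : WeightLE c e w (0 : Fin m → Poly K n) := fun _ _ => map_zero _

theorem mono (h : WeightLE c e w f) (hw : w ≤ w') : WeightLE c e w' f :=
  fun k hk => h k (hw.trans_lt hk)

theorem add (hf : WeightLE c e w f) (hg : WeightLE c e w g) : WeightLE c e w (f + g) :=
  fun k hk => by rw [map_add, hf k hk, hg k hk, add_zero]

theorem sub (hf : WeightLE c e w f) (hg : WeightLE c e w g) : WeightLE c e w (f - g) :=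
  fun k hk => by rw [map_sub, hf k hk, hg k hk, sub_zero]

theorem zsmul (hf : WeightLE c e w f) (a : ℤ) : WeightLE c e w (a • f) :=
  fun k hk => by rw [map_zsmul, hf k hk, smul_zero]

theorem C_smul (hf : WeightLE c e w f) (a : K) : WeightLE c e w ((C a : Poly K n) • f) :=
  fun k hk => by rw [wcomp_C_smul, hf k hk, smul_zero]

theorem X_smul (hf : WeightLE c e w f) (i : Fin n) :
    WeightLE c e (w + c i) ((X i : Poly K n) • f) :=
  fun k hk => by rw [wcomp_X_smul, hf _ (by lia), smul_zero]

theorem sum {ι : Type*} {s : Finset ι} {f : ι → Fin m → Poly K n}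
    (h : ∀ i ∈ s, WeightLE c e w (f i)) : WeightLE c e w (∑ i ∈ s, f i) :=
  fun k hk => by rw [map_sum]; exact Finset.sum_eq_zero fun i hi => h i hi k hk

theorem wcomp_right (hf : WeightLE c e w f) (c' : Fin n → ℕ) (e' : Fin m → ℤ) (k' : ℤ) :
    WeightLE c e w (wcomp c' e' k' f) :=
  fun k hk => by rw [wcomp_wcomp, hf k hk, map_zero]

theorem of_wcomp (hf : wcomp c e w f = f) : WeightLE c e w f :=
  fun _ hk => wcomp_of_ne hf hk.ne'

theorem sub_wcomp (hf : WeightLE c e w f) : WeightLE c e (w - 1) (f - wcomp c e w f) := by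
  intro k hk
  rw [map_sub, wcomp_idem]
  split_ifs with h
  · rw [sub_self]
  · rw [hf k (by lia), sub_zero]

theorem wcomp_eq (h : WeightLE c e (w - 1) (f - g)) : wcomp c e w f = wcomp c e w g := by
  have := h w (by lia)
  rwa [map_sub, sub_eq_zero] at this

end WeightLE

theorem exists_weightLE (c : Fin n → ℕ) (e : Fin m → ℤ) (f : Fin m → Poly K n) :
    ∃ w, WeightLE c e w f := by
  obtain ⟨s, hs, -⟩ := exists_finset_wcomp c e f
  obtain ⟨w, hw⟩ := s.bddAbove
  exact ⟨w, fun k hk => hs k fun hks => absurd (hw hks) (not_le.2 hk)⟩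

theorem wcomp_eq_zero_of_lt {c : Fin n → ℕ} {e : Fin m → ℤ} {b k : ℤ} (he : ∀ j, b ≤ e j)
    (hk : k < b) (f : Fin m → Poly K n) : wcomp c e k f = 0 := by
  refine ext_coeff fun j u => ?_
  rw [coeff_wcomp, if_neg]
  · rfl
  · have := he j
    rw [wt]
    lia

/-- Variables have nonnegative weight, so no monomial lies below the smallest basis weight. Every
descent on the weight terminates for this reason. -/
theorem eq_zero_of_weightLE {c : Fin n → ℕ} {e : Fin m → ℤ} {b w : ℤ} (he : ∀ j, b ≤ e j)
    (hw : w < b) {f : Fin m → Poly K n} (hf : WeightLE c e w f) : f = 0 :=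
  eq_zero_of_wcomp (c := c) (e := e) fun k =>
    if h : w < k then hf k h else wcomp_eq_zero_of_lt he (by lia) f

theorem wcomp_single (c : Fin n → ℕ) (e : Fin m → ℤ) (k : ℤ) (j : Fin m) :
    wcomp c e k (Pi.single j (1 : Poly K n)) = if k = e j then Pi.single j 1 else 0 := by
  refine ext_coeff fun j' u => ?_
  rw [coeff_wcomp]
  by_cases hj : j' = j
  · subst hj
    by_cases hu : u = 0
    · subst hu
      by_cases hk : k = e j'
      · simp [wt, hk]
      · simp [wt, hk, Ne.symm hk]
    · split_ifs <;> simp [coeff_one, Ne.symm hu]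
  · split_ifs <;> simp [hj]

/-- The map commutes with taking components for the given weights. -/
def Preserves (c : Fin n → ℕ) (e : Fin r → ℤ) (e' : Fin m → ℤ)
    (φ : (Fin r → Poly K n) →ₗ[Poly K n] (Fin m → Poly K n)) : Prop :=
  ∀ k g, φ (wcomp c e k g) = wcomp c e' k (φ g)

theorem preserves_of_basis {c : Fin n → ℕ} {e : Fin r → ℤ} {e' : Fin m → ℤ}
    {φ : (Fin r → Poly K n) →ₗ[Poly K n] (Fin m → Poly K n)}
    (h : ∀ l, wcomp c e' (e l) (φ (Pi.single l 1)) = φ (Pi.single l 1)) :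
    Preserves c e e' φ := by
  suffices H : ∀ g k, φ (wcomp c e k g) = wcomp c e' k (φ g) from fun k g => H g k
  refine free_induction ?_ (by simp) ?_ ?_ ?_
  · intro l k
    rw [wcomp_single]
    split_ifs with hk
    · rw [hk, h]
    · rw [map_zero, wcomp_of_ne (h l) hk]
  · intro x y hx hy k
    rw [map_add, map_add, map_add, map_add, hx, hy]
  · intro a x hx k
    rw [wcomp_C_smul, map_smul, map_smul, wcomp_C_smul, hx]
  · intro i x hx k
    rw [wcomp_X_smul, map_smul, map_smul, wcomp_X_smul, hx]

theorem preserves_of_homogeneous {c : Fin n → ℕ} {e : Fin r → ℤ} {e' : Fin m → ℤ}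
    {φ : (Fin r → Poly K n) →ₗ[Poly K n] (Fin m → Poly K n)}
    (h : ∀ k g, wcomp c e k g = g → wcomp c e' k (φ g) = φ g) : Preserves c e e' φ :=
  preserves_of_basis fun l => h _ _ (by rw [wcomp_single, if_pos rfl])

namespace Preserves

variable {c : Fin n → ℕ} {e : Fin r → ℤ} {e' : Fin m → ℤ}
  {φ : (Fin r → Poly K n) →ₗ[Poly K n] (Fin m → Poly K n)}

theorem map_eq (h : Preserves c e e' φ) {k : ℤ} {g : Fin r → Poly K n}
    (hg : wcomp c e k g = g) : wcomp c e' k (φ g) = φ g := by rw [← h, hg]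

theorem comp {p : ℕ} {e'' : Fin p → ℤ} {ψ : (Fin m → Poly K n) →ₗ[Poly K n] (Fin p → Poly K n)}
    (hψ : Preserves c e' e'' ψ) (h : Preserves c e e' φ) : Preserves c e e'' (ψ ∘ₗ φ) :=
  fun k g => by rw [LinearMap.comp_apply, h, hψ, LinearMap.comp_apply]

theorem ker_mem (h : Preserves c e e' φ) {g : Fin r → Poly K n} (hg : g ∈ LinearMap.ker φ) (k : ℤ) :
    wcomp c e k g ∈ LinearMap.ker φ := by
  rw [LinearMap.mem_ker, h, LinearMap.mem_ker.1 hg, map_zero]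

end Preserves

/-- A map that lowers the weight of the basis elements lowers all weights. -/
theorem weightLE_of_basis {c : Fin n → ℕ} {e : Fin r → ℤ} {e' : Fin m → ℤ}
    {ψ : (Fin r → Poly K n) →ₗ[Poly K n] (Fin m → Poly K n)}
    (h : ∀ l, WeightLE c e' (e l - 1) (ψ (Pi.single l 1))) {w : ℤ} {g : Fin r → Poly K n}
    (hg : WeightLE c e w g) : WeightLE c e' (w - 1) (ψ g) := by
  have H : ∀ (g : Fin r → Poly K n) (k : ℤ), WeightLE c e' (k - 1) (ψ (wcomp c e k g)) := by
    refine free_induction ?_ ?_ ?_ ?_ ?_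
    · intro l k
      rw [wcomp_single]
      split_ifs with hk
      · rw [hk]; exact h l
      · rw [map_zero]; exact WeightLE.zero
    · intro k
      rw [map_zero, map_zero]; exact WeightLE.zero
    · intro x y hx hy k
      rw [map_add, map_add]; exact (hx k).add (hy k)
    · intro a x hx k
      rw [wcomp_C_smul, map_smul]; exact (hx k).C_smul a
    · intro i x hx k
      rw [wcomp_X_smul, map_smul]
      exact ((hx _).X_smul i).mono (by lia)
  obtain ⟨s, -, hs⟩ := exists_finset_wcomp c e g
  rw [hs, map_sum]
  refine WeightLE.sum fun k _ => ?_
  by_cases hk : w < k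
  · rw [hg k hk, map_zero]; exact WeightLE.zero
  · exact (H g k).mono (by lia)

end Components

/-! ### Graded submodules, their homogeneous pieces and the components N_{⟨a⟩}. -/

section Graded

variable {K : Type*} [Field K] {n m r : ℕ}

theorem isHomogeneous_iff {d : Fin m → ℤ} {k : ℤ} {f : Fin m → Poly K n} :
    IsHomogeneous d k f ↔ wcomp 1 d k f = f := by
  have hdeg : ∀ j (u : Fin n →₀ ℕ), wt 1 d j u = ((Finsupp.degree u : ℕ) : ℤ) + d j := fun j u => by
    rw [wt, Finsupp.degree_eq_sum]; simp
  constructor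
  · intro h
    refine ext_coeff fun j u => ?_
    rw [coeff_wcomp]
    split_ifs with hk
    · rfl
    · by_contra h0
      exact hk ((hdeg j u).trans (h j u (mem_support_iff.2 (Ne.symm h0))))
  · intro h j u hu
    rw [mem_support_iff, ← h, coeff_wcomp] at hu
    rw [← hdeg]
    by_contra h0
    exact hu (if_neg h0)

theorem isHomogeneous_preserves_iff {d : Fin r → ℤ} {d' : Fin m → ℤ}
    {φ : (Fin r → Poly K n) →ₗ[Poly K n] (Fin m → Poly K n)} :
    (∀ k x, IsHomogeneous d k x → IsHomogeneous d' k (φ x)) ↔ Preserves 1 d d' φ := by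
  simp only [isHomogeneous_iff]
  exact ⟨preserves_of_homogeneous, fun h _ _ => h.map_eq⟩

/-- The elements all of whose components lie in `N` form a submodule. -/
theorem wcomp_mem_of_span {c : Fin n → ℕ} {e : Fin m → ℤ} {N : Submodule (Poly K n) (Fin m → Poly K n)}
    {s : Set (Fin m → Poly K n)} (hs : ∀ f ∈ s, ∀ k, wcomp c e k f ∈ N) {f : Fin m → Poly K n}
    (hf : f ∈ Submodule.span (Poly K n) s) : ∀ k, wcomp c e k f ∈ N := by
  refine span_poly_induction hs (by simp) ?_ ?_ ?_ f hf
  · intro x y hx hy k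
    rw [map_add]; exact N.add_mem (hx k) (hy k)
  · intro a x hx k
    rw [wcomp_C_smul]; exact N.smul_mem _ (hx k)
  · intro i x hx k
    rw [wcomp_X_smul]; exact N.smul_mem _ (hx _)

theorem wcomp_mem_span {c : Fin n → ℕ} {e : Fin m → ℤ}
    {s : Set (Fin m → Poly K n)} (hs : ∀ f ∈ s, ∃ k, wcomp c e k f = f) {f : Fin m → Poly K n}
    (hf : f ∈ Submodule.span (Poly K n) s) (k : ℤ) :
    wcomp c e k f ∈ Submodule.span (Poly K n) s := by
  refine wcomp_mem_of_span (fun f hf k => ?_) hf k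
  obtain ⟨k', hk'⟩ := hs f hf
  by_cases h : k = k'
  · rw [h, hk']; exact Submodule.subset_span hf
  · rw [wcomp_of_ne hk' h]; exact Submodule.zero_mem _

theorem isGraded_iff {d : Fin m → ℤ} {N : Submodule (Poly K n) (Fin m → Poly K n)} :
    IsGraded d N ↔ ∀ f ∈ N, ∀ k, wcomp 1 d k f ∈ N := by
  constructor
  · intro h f hf k
    unfold IsGraded at h
    rw [← h] at hf ⊢
    exact wcomp_mem_span (fun g hg => hg.2.imp fun k hk => isHomogeneous_iff.1 hk) hf k
  · intro h
    refine le_antisymm (Submodule.span_le.2 fun f hf => hf.1) fun f hf => ?_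
    refine mem_of_wcomp_mem (c := 1) (e := d) fun k => Submodule.subset_span ⟨h f hf k, k, ?_⟩
    rw [isHomogeneous_iff, wcomp_self]

/-- The homogeneous elements of degree `q` of a submodule. -/
noncomputable def piece (d : Fin m → ℤ) (N : Submodule (Poly K n) (Fin m → Poly K n)) (q : ℤ) :
    AddSubgroup (Fin m → Poly K n) where
  carrier := {f | f ∈ N ∧ wcomp 1 d q f = f}
  zero_mem' := ⟨N.zero_mem, map_zero _⟩
  add_mem' := fun ha hb => ⟨N.add_mem ha.1 hb.1, by rw [map_add, ha.2, hb.2]⟩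
  neg_mem' := fun ha => ⟨N.neg_mem ha.1, by rw [map_neg, ha.2]⟩

theorem mem_piece {d : Fin m → ℤ} {N : Submodule (Poly K n) (Fin m → Poly K n)} {q : ℤ}
    {f : Fin m → Poly K n} : f ∈ piece d N q ↔ f ∈ N ∧ wcomp 1 d q f = f := Iff.rfl

theorem wcomp_mem_piece {d : Fin m → ℤ} {N : Submodule (Poly K n) (Fin m → Poly K n)}
    (hN : IsGraded d N) {f : Fin m → Poly K n} (hf : f ∈ N) (q : ℤ) :
    wcomp 1 d q f ∈ piece d N q :=
  ⟨isGraded_iff.1 hN f hf q, wcomp_self _ _ _ _⟩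

theorem X_smul_eq {d : Fin m → ℤ} {q : ℤ} {f : Fin m → Poly K n} (hf : wcomp 1 d q f = f)
    (i : Fin n) : wcomp 1 d (q + 1) ((X i : Poly K n) • f) = (X i : Poly K n) • f := by
  rw [wcomp_X_smul, Pi.one_apply, Nat.cast_one, add_sub_cancel_right, hf]

theorem X_smul_mem_piece {d : Fin m → ℤ} {N : Submodule (Poly K n) (Fin m → Poly K n)} {q : ℤ}
    {f : Fin m → Poly K n} (hf : f ∈ piece d N q) (i : Fin n) :
    (X i : Poly K n) • f ∈ piece d N (q + 1) :=
  ⟨N.smul_mem _ hf.1, X_smul_eq hf.2 i⟩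

theorem C_smul_mem_piece {d : Fin m → ℤ} {N : Submodule (Poly K n) (Fin m → Poly K n)} {q : ℤ}
    {f : Fin m → Poly K n} (hf : f ∈ piece d N q) (a : K) :
    (C a : Poly K n) • f ∈ piece d N q :=
  ⟨N.smul_mem _ hf.1, by rw [wcomp_C_smul, hf.2]⟩

theorem component_eq_span (d : Fin m → ℤ) (a : ℤ) (N : Submodule (Poly K n) (Fin m → Poly K n)) :
    component d a N = Submodule.span (Poly K n) (piece d N a : Set (Fin m → Poly K n)) := by
  unfold component
  congr 1
  ext f
  exact and_congr Iff.rfl isHomogeneous_iff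

theorem component_le (d : Fin m → ℤ) (a : ℤ) (N : Submodule (Poly K n) (Fin m → Poly K n)) :
    component d a N ≤ N := by
  rw [component_eq_span]
  exact Submodule.span_le.2 fun f hf => hf.1

theorem isGraded_component (d : Fin m → ℤ) (a : ℤ) (N : Submodule (Poly K n) (Fin m → Poly K n)) :
    IsGraded d (component d a N) := by
  rw [isGraded_iff, component_eq_span]
  exact fun f hf k => wcomp_mem_span (fun g hg => ⟨a, hg.2⟩) hf k

theorem piece_component_self (d : Fin m → ℤ) (a : ℤ)
    (N : Submodule (Poly K n) (Fin m → Poly K n)) :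
    piece d (component d a N) a = piece d N a := by
  refine le_antisymm (fun f hf => ⟨component_le d a N hf.1, hf.2⟩) fun f hf => ⟨?_, hf.2⟩
  rw [component_eq_span]
  exact Submodule.subset_span hf

/-- A graded submodule generated in degrees at most `q` is generated in degree `q` from
degree `q` on. -/
theorem exists_sum_X_smul_of_span {d : Fin m → ℤ} {s : Set (Fin m → Poly K n)} {q : ℤ}
    (hs : ∀ f ∈ s, ∃ k ≤ q, wcomp 1 d k f = f) {f : Fin m → Poly K n}
    (hf : f ∈ piece d (Submodule.span (Poly K n) s) (q + 1)) :
    ∃ g : Fin n → Fin m → Poly K n, (∀ i, g i ∈ piece d (Submodule.span (Poly K n) s) q) ∧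
      f = ∑ i, (X i : Poly K n) • g i := by
  classical
  set N := Submodule.span (Poly K n) s with hN
  -- Quantifying over all components of an arbitrary element makes the claim accessible to span
  -- induction. In the variable step the decomposition is immediate, and only membership of `x` in
  -- `N` is needed.
  have key : ∀ f ∈ N, ∀ k, q + 1 ≤ k → ∃ g : Fin n → Fin m → Poly K n,
      (∀ i, g i ∈ piece d N (k - 1)) ∧ wcomp 1 d k f = ∑ i, (X i : Poly K n) • g i := by
    intro f hf
    have h1 : f ∈ N ∧ ∀ k, q + 1 ≤ k → ∃ g : Fin n → Fin m → Poly K n,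
      (∀ i, g i ∈ piece d N (k - 1)) ∧ wcomp 1 d k f = ∑ i, (X i : Poly K n) • g i := by
      refine span_poly_induction (P := fun f => f ∈ N ∧ ∀ k, q + 1 ≤ k →
        ∃ g : Fin n → Fin m → Poly K n, (∀ i, g i ∈ piece d N (k - 1)) ∧
          wcomp 1 d k f = ∑ i, (X i : Poly K n) • g i) ?_ ?_ ?_ ?_ ?_ f hf
      · intro f hf
        refine ⟨Submodule.subset_span hf, fun k hk => ⟨0, fun _ => AddSubgroup.zero_mem _, ?_⟩⟩
        obtain ⟨k', hk', h⟩ := hs f hf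
        rw [wcomp_of_ne h (by lia)]
        simp
      · exact ⟨N.zero_mem, fun k hk => ⟨0, fun _ => AddSubgroup.zero_mem _, by simp⟩⟩
      · rintro x y ⟨hxN, hx⟩ ⟨hyN, hy⟩
        refine ⟨N.add_mem hxN hyN, fun k hk => ?_⟩
        obtain ⟨g, hg, hg'⟩ := hx k hk
        obtain ⟨h, hh, hh'⟩ := hy k hk
        refine ⟨fun i => g i + h i, fun i => AddSubgroup.add_mem _ (hg i) (hh i), ?_⟩
        rw [map_add, hg', hh', ← Finset.sum_add_distrib]
        simp only [smul_add]
      · rintro a x ⟨hxN, hx⟩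
        refine ⟨N.smul_mem _ hxN, fun k hk => ?_⟩
        obtain ⟨g, hg, hg'⟩ := hx k hk
        refine ⟨fun i => (C a : Poly K n) • g i, fun i => C_smul_mem_piece (hg i) a, ?_⟩
        rw [wcomp_C_smul, hg', Finset.smul_sum]
        exact Finset.sum_congr rfl fun i _ => smul_comm _ _ _
      · rintro i x ⟨hxN, -⟩
        refine ⟨N.smul_mem _ hxN, fun k hk => ⟨Pi.single i (wcomp 1 d (k - 1) x), fun i' => ?_, ?_⟩⟩
        · rcases eq_or_ne i' i with rfl | h
          · rw [Pi.single_eq_same]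
            refine ⟨wcomp_mem_span (fun g hg => ?_) hxN _, wcomp_self _ _ _ _⟩
            obtain ⟨k, -, h⟩ := hs g hg
            exact ⟨k, h⟩
          · rw [Pi.single_eq_of_ne h]; exact AddSubgroup.zero_mem _
        · rw [wcomp_X_smul, Finset.sum_eq_single i]
          · simp
          · intro j _ hj
            rw [Pi.single_eq_of_ne hj, smul_zero]
          · simp
    exact h1.2
  obtain ⟨g, hg, h⟩ := key f hf.1 (q + 1) le_rfl
  rw [add_sub_cancel_right] at hg
  exact ⟨g, hg, by rw [← h, hf.2]⟩

theorem exists_sum_X_smul_component {d : Fin m → ℤ} {a q : ℤ} (hq : a ≤ q)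
    {N : Submodule (Poly K n) (Fin m → Poly K n)} {f : Fin m → Poly K n}
    (hf : f ∈ piece d (component d a N) (q + 1)) :
    ∃ g : Fin n → Fin m → Poly K n, (∀ i, g i ∈ piece d (component d a N) q) ∧
      f = ∑ i, (X i : Poly K n) • g i := by
  rw [component_eq_span] at hf ⊢
  exact exists_sum_X_smul_of_span (fun f hf => ⟨a, hq, hf.2⟩) hf

end Graded

/-! ### Initial parts and initial modules in terms of weight components. -/

section Initial

variable {K : Type*} [Field K] {n m : ℕ}

/-- The weights of the basis elements as integers. -/
abbrev intWeight (ε : Fin m → ℕ) : Fin m → ℤ := fun j => (ε j : ℤ)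

theorem wcomp_topWeight (ω : Fin n → ℕ) (ε : Fin m → ℕ) (f : Fin m → Poly K n) :
    wcomp ω (intWeight ε) (topWeight ω ε f) f = initialPart ω ε f := by
  classical
  refine ext_coeff fun j u => ?_
  have hiff : wt ω (intWeight ε) j u = topWeight ω ε f ↔
      (∑ i, ω i * u i) + ε j = topWeight ω ε f := by
    rw [wt]; exact_mod_cast Iff.rfl
  rw [coeff_wcomp, initialPart, coeff_sum]
  simp only [coeff_monomial]
  rw [Finset.sum_ite_eq']
  by_cases h : (∑ i, ω i * u i) + ε j = topWeight ω ε f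
  · rw [if_pos (hiff.2 h)]
    by_cases h0 : coeff u (f j) = 0
    · simp [h0]
    · rw [if_pos (Finset.mem_filter.2 ⟨mem_support_iff.2 h0, h⟩)]
  · rw [if_neg (hiff.not.2 h), if_neg]
    exact fun h' => h (Finset.mem_filter.1 h').2

theorem weightLE_topWeight (ω : Fin n → ℕ) (ε : Fin m → ℕ) (f : Fin m → Poly K n) :
    WeightLE ω (intWeight ε) (topWeight ω ε f) f := by
  intro k hk
  refine ext_coeff fun j u => ?_
  rw [coeff_wcomp]
  split_ifs with h
  · by_contra h0
    have h1 : (∑ i, ω i * u i) + ε j ≤ topWeight ω ε f :=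
      (Finset.le_sup (f := fun u => (∑ i, ω i * u i) + ε j)
        (mem_support_iff.2 h0)).trans
        (Finset.le_sup (f := fun j => (f j).support.sup fun u => (∑ i, ω i * u i) + ε j)
          (Finset.mem_univ j))
    rw [wt] at h
    have h2 : ((∑ i, ω i * u i : ℕ) : ℤ) + (ε j : ℤ) ≤ topWeight ω ε f := by exact_mod_cast h1
    exact absurd (h ▸ hk) (not_lt.2 h2)
  · rfl

theorem initialPart_ne_zero (ω : Fin n → ℕ) (ε : Fin m → ℕ) {f : Fin m → Poly K n} (hf : f ≠ 0) :
    initialPart ω ε f ≠ 0 := by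
  obtain ⟨j, hj⟩ := Function.ne_iff.1 hf
  have hj' : (f j).support.Nonempty := by rwa [MvPolynomial.support_nonempty]
  let S : Finset (Σ _ : Fin m, Fin n →₀ ℕ) := Finset.univ.sigma fun j => (f j).support
  obtain ⟨u, hu⟩ := hj'
  obtain ⟨⟨j', u'⟩, hm, hmax⟩ := S.exists_max_image
    (fun x => (∑ i, ω i * x.2 i) + ε x.1) ⟨⟨j, u⟩, by simpa [S] using hu⟩
  have htop : topWeight ω ε f = (∑ i, ω i * u' i) + ε j' := by
    refine le_antisymm (Finset.sup_le fun i _ => Finset.sup_le fun v hv => ?_) ?_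
    · exact hmax ⟨i, v⟩ (by simpa [S] using hv)
    · have hm' : u' ∈ (f j').support := by simpa [S] using hm
      exact (Finset.le_sup (f := fun u => (∑ i, ω i * u i) + ε j') hm').trans
        (Finset.le_sup (f := fun j => (f j).support.sup fun u => (∑ i, ω i * u i) + ε j)
          (Finset.mem_univ j'))
  rw [← wcomp_topWeight]
  intro h0
  have := congrArg (fun g => coeff u' (g j')) h0
  simp only [coeff_wcomp] at this
  rw [if_pos (by rw [htop, wt]; push_cast; rfl)] at this
  have hm' : u' ∈ (f j').support := by simpa [S] using hm
  exact (mem_support_iff.1 hm') (by simpa using this)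

/-- Upper bounds on the weight propagate more easily than the exact top weight. A bound whose
component is nonzero is the top weight. -/
theorem initialPart_eq_wcomp {ω : Fin n → ℕ} {ε : Fin m → ℕ} {f : Fin m → Poly K n} {w : ℤ}
    (hf : WeightLE ω (intWeight ε) w f) (h0 : wcomp ω (intWeight ε) w f ≠ 0) :
    initialPart ω ε f = wcomp ω (intWeight ε) w f := by
  have hne : f ≠ 0 := by rintro rfl; exact h0 (map_zero _)
  have : (topWeight ω ε f : ℤ) = w := by
    refine le_antisymm (not_lt.1 fun h => ?_) (not_lt.1 fun h => ?_)
    · exact initialPart_ne_zero ω ε hne (by rw [← wcomp_topWeight]; exact hf _ h)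
    · exact h0 (weightLE_topWeight ω ε f w h)
  rw [← wcomp_topWeight, this]

/-- An element lies in the initial module if and only if each of its weight components is the
leading form of an element of the module. -/
theorem mem_initialModule_iff {ω : Fin n → ℕ} {ε : Fin m → ℕ}
    {N : Submodule (Poly K n) (Fin m → Poly K n)} {f : Fin m → Poly K n} :
    f ∈ initialModule ω ε N ↔ ∀ w, ∃ g ∈ N,
      WeightLE ω (intWeight ε) (w - 1) (g - wcomp ω (intWeight ε) w f) := by
  constructor
  · intro hf
    refine span_poly_induction (P := fun f => ∀ w, ∃ g ∈ N,
      WeightLE ω (intWeight ε) (w - 1) (g - wcomp ω (intWeight ε) w f)) ?_ ?_ ?_ ?_ ?_ f hf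
    · rintro _ ⟨g, hg, -, rfl⟩ w
      rw [← wcomp_topWeight, wcomp_idem]
      split_ifs with h
      · refine ⟨g, hg, WeightLE.sub_wcomp ?_⟩
        rw [h]; exact weightLE_topWeight ω ε g
      · exact ⟨0, N.zero_mem, by rw [sub_zero]; exact WeightLE.zero⟩
    · exact fun w => ⟨0, N.zero_mem, by rw [map_zero, sub_zero]; exact WeightLE.zero⟩
    · intro x y hx hy w
      obtain ⟨g, hg, hg'⟩ := hx w
      obtain ⟨h, hh, hh'⟩ := hy w
      refine ⟨g + h, N.add_mem hg hh, ?_⟩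
      rw [map_add, add_sub_add_comm]
      exact hg'.add hh'
    · intro a x hx w
      obtain ⟨g, hg, hg'⟩ := hx w
      refine ⟨(C a : Poly K n) • g, N.smul_mem _ hg, ?_⟩
      rw [wcomp_C_smul, ← smul_sub]
      exact hg'.C_smul a
    · intro i x hx w
      obtain ⟨g, hg, hg'⟩ := hx (w - ω i)
      refine ⟨(X i : Poly K n) • g, N.smul_mem _ hg, ?_⟩
      rw [wcomp_X_smul, ← smul_sub]
      exact (hg'.X_smul i).mono (by lia)
  · intro h
    refine mem_of_wcomp_mem (c := ω) (e := intWeight ε) fun w => ?_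
    obtain ⟨g, hg, hg'⟩ := h w
    -- If the component vanishes, `g` is merely some element of smaller weight and its initial part
    -- is irrelevant.
    by_cases h0 : wcomp ω (intWeight ε) w f = 0
    · rw [h0]; exact Submodule.zero_mem _
    · have h1 : wcomp ω (intWeight ε) w g = wcomp ω (intWeight ε) w f := by
        rw [hg'.wcomp_eq, wcomp_self]
      have h2 : WeightLE ω (intWeight ε) w g := by
        have := (hg'.mono (by lia : w - 1 ≤ w)).add (WeightLE.of_wcomp (wcomp_self ω (intWeight ε) w f))
        rwa [sub_add_cancel] at this
      refine Submodule.subset_span ⟨g, hg, ?_, ?_⟩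
      · rintro rfl
        exact h0 (by rw [← h1, map_zero])
      · rw [initialPart_eq_wcomp h2 (by rwa [h1]), h1]

/-- Only an upper bound on the weight is required; if it is not attained, the component is zero. -/
theorem wcomp_mem_initialModule {ω : Fin n → ℕ} {ε : Fin m → ℕ}
    {N : Submodule (Poly K n) (Fin m → Poly K n)} {f : Fin m → Poly K n} (hf : f ∈ N) {w : ℤ}
    (hw : WeightLE ω (intWeight ε) w f) : wcomp ω (intWeight ε) w f ∈ initialModule ω ε N := by
  rw [mem_initialModule_iff]
  intro k
  rw [wcomp_idem]
  split_ifs with h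
  · rw [h]; exact ⟨f, hf, hw.sub_wcomp⟩
  · exact ⟨0, N.zero_mem, by rw [sub_zero]; exact WeightLE.zero⟩

theorem initialModule_weight {ω : Fin n → ℕ} {ε : Fin m → ℕ}
    {N : Submodule (Poly K n) (Fin m → Poly K n)} {f : Fin m → Poly K n}
    (hf : f ∈ initialModule ω ε N) (w : ℤ) :
    wcomp ω (intWeight ε) w f ∈ initialModule ω ε N := by
  rw [mem_initialModule_iff] at hf ⊢
  intro k
  rw [wcomp_idem]
  split_ifs with h
  · exact hf k
  · exact ⟨0, N.zero_mem, by rw [sub_zero]; exact WeightLE.zero⟩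

/-- Degree and weight components commute, so a lift of a leading form may be replaced by its
component of degree `q`. -/
theorem exists_piece_of_initialModule {ω : Fin n → ℕ} {ε : Fin m → ℕ} {d : Fin m → ℤ}
    {N : Submodule (Poly K n) (Fin m → Poly K n)} (hN : IsGraded d N) {f : Fin m → Poly K n}
    (hf : f ∈ initialModule ω ε N) (q w : ℤ) :
    ∃ g ∈ piece d N q, WeightLE ω (intWeight ε) (w - 1)
      (g - wcomp ω (intWeight ε) w (wcomp 1 d q f)) := by
  obtain ⟨g, hg, hg'⟩ := mem_initialModule_iff.1 hf w
  refine ⟨_, wcomp_mem_piece hN hg q, ?_⟩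
  rw [wcomp_wcomp, ← map_sub]
  exact hg'.wcomp_right _ _ _

theorem isGraded_initialModule {ω : Fin n → ℕ} {ε : Fin m → ℕ} {d : Fin m → ℤ}
    {N : Submodule (Poly K n) (Fin m → Poly K n)} (hN : IsGraded d N) :
    IsGraded d (initialModule ω ε N) := by
  rw [isGraded_iff]
  intro f hf k
  rw [mem_initialModule_iff]
  intro w
  obtain ⟨g, hg, hg'⟩ := exists_piece_of_initialModule hN hf k w
  exact ⟨g, hg.1, hg'⟩

end Initial

/-! ### The Koszul complex with coefficients, and regularity as vanishing of its homology. -/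

section Koszul

variable {K : Type*} [Field K] {n : ℕ}

/-- The sign with which `e_j ∧ e_S` contributes to the Koszul differential. -/
def koszulSign (j : Fin n) (S : Finset (Fin n)) : ℤ := ∏ s ∈ S, if s < j then -1 else 1

theorem koszulSign_insert (j k : Fin n) {S : Finset (Fin n)} (hk : k ∉ S) :
    koszulSign j (insert k S) = (if k < j then -1 else 1) * koszulSign j S :=
  Finset.prod_insert hk

theorem koszulSign_of_lt {j : Fin n} {S : Finset (Fin n)} (h : ∀ s ∈ S, j < s) :
    koszulSign j S = 1 :=
  Finset.prod_eq_one fun s hs => if_neg (h s hs).asymm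

theorem koszulSign_insert_mul {j k : Fin n} {S : Finset (Fin n)} (hj : j ∉ S) (hk : k ∉ S)
    (hjk : j ≠ k) :
    koszulSign j (insert k S) * koszulSign k S = -(koszulSign k (insert j S) * koszulSign j S) := by
  rw [koszulSign_insert j k hk, koszulSign_insert k j hj]
  rcases lt_or_gt_of_ne hjk with h | h
  · rw [if_neg h.asymm, if_pos h]; ring
  · rw [if_pos h, if_neg h.asymm]; ring

variable {T T' : Type*} [AddCommGroup T] [Module (Poly K n) T] [AddCommGroup T']
  [Module (Poly K n) T']

/-- The differential of the Koszul complex of `X₁, …, Xₙ` with coefficients in `T`. A chain is a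
family of coefficients indexed by the subsets of the variables. -/
noncomputable def koszulD (K : Type*) [Field K] {n : ℕ} {T : Type*} [AddCommGroup T]
    [Module (Poly K n) T] (z : Finset (Fin n) → T) (S : Finset (Fin n)) : T :=
  ∑ j ∈ Sᶜ, koszulSign j S • ((X j : Poly K n) • z (insert j S))

theorem koszulD_add (y z : Finset (Fin n) → T) :
    koszulD K (y + z) = koszulD K y + koszulD K z := by
  funext S
  simp only [koszulD, Pi.add_apply, smul_add, Finset.sum_add_distrib]

theorem koszulD_neg (z : Finset (Fin n) → T) : koszulD K (-z) = -koszulD K z := by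
  funext S
  simp only [koszulD, Pi.neg_apply, smul_neg, Finset.sum_neg_distrib]

theorem koszulD_sub (y z : Finset (Fin n) → T) :
    koszulD K (y - z) = koszulD K y - koszulD K z := by
  rw [sub_eq_add_neg, koszulD_add, koszulD_neg, ← sub_eq_add_neg]

theorem koszulD_zero : koszulD K (0 : Finset (Fin n) → T) = 0 := by
  funext S
  simp [koszulD]

theorem koszulD_map (φ : T →ₗ[Poly K n] T') (z : Finset (Fin n) → T) :
    koszulD K (fun S => φ (z S)) = fun S => φ (koszulD K z S) := by
  funext S
  simp only [koszulD, map_sum, map_zsmul, map_smul]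

theorem koszulD_koszulD (z : Finset (Fin n) → T) : koszulD K (koszulD K z) = 0 := by
  funext S
  -- Zero terms on the diagonal extend the double sum to Sᶜ × Sᶜ, where exchanging the two indices
  -- is an involution that cancels terms in pairs.
  have h1 : ∀ j ∈ Sᶜ, koszulSign j S • ((X j : Poly K n) • koszulD K z (insert j S)) =
      ∑ k ∈ Sᶜ, if j = k then 0 else (koszulSign k (insert j S) * koszulSign j S) •
        ((X j * X k : Poly K n) • z (insert k (insert j S))) := by
    intro j hj
    rw [koszulD, Finset.compl_insert, Finset.smul_sum, Finset.smul_sum, ← Finset.sum_erase_add _ _ hj,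
      if_pos rfl, add_zero]
    refine Finset.sum_congr rfl fun k hk => ?_
    rw [if_neg (Finset.ne_of_mem_erase hk).symm, smul_comm (X j : Poly K n) (koszulSign k _),
      smul_smul, smul_smul, mul_comm]
  rw [koszulD, Finset.sum_congr rfl h1, Pi.zero_apply, ← Finset.sum_product']
  refine Finset.sum_involution (fun p _ => (p.2, p.1)) ?_ ?_ ?_ ?_
  · rintro ⟨j, k⟩ hp
    rw [Finset.mem_product] at hp
    by_cases hjk : j = k
    · simp [hjk]
    · dsimp only
      rw [if_neg hjk, if_neg (Ne.symm hjk),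
        koszulSign_insert_mul (Finset.mem_compl.1 hp.1) (Finset.mem_compl.1 hp.2) hjk,
        Finset.insert_comm, mul_comm (X j), neg_smul]
      exact add_neg_cancel (_ : T)
  · rintro ⟨j, k⟩ _ h0 heq
    apply h0
    dsimp only
    rw [if_pos]
    exact ((Prod.mk.injEq _ _ _ _).mp heq).2
  · rintro ⟨j, k⟩ hp
    rw [Finset.mem_product] at hp ⊢
    exact ⟨hp.2, hp.1⟩
  · rintro ⟨j, k⟩ _
    rfl

/-- `z` is a Koszul chain of homological degree `i` with coefficients in `U`. -/
def IsChain (U : AddSubgroup T) (i : ℕ) (z : Finset (Fin n) → T) : Prop :=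
  ∀ S, z S ∈ U ∧ (S.card ≠ i → z S = 0)

namespace IsChain

variable {U U' : AddSubgroup T} {i : ℕ} {y z : Finset (Fin n) → T}

theorem zero : IsChain U i (0 : Finset (Fin n) → T) := fun _ => ⟨U.zero_mem, fun _ => rfl⟩

theorem add (hy : IsChain U i y) (hz : IsChain U i z) : IsChain U i (y + z) :=
  fun S => ⟨U.add_mem (hy S).1 (hz S).1, fun h => by
    rw [Pi.add_apply, (hy S).2 h, (hz S).2 h, add_zero]⟩

theorem sub (hy : IsChain U i y) (hz : IsChain U i z) : IsChain U i (y - z) :=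
  fun S => ⟨U.sub_mem (hy S).1 (hz S).1, fun h => by
    rw [Pi.sub_apply, (hy S).2 h, (hz S).2 h, sub_zero]⟩

theorem mono (hz : IsChain U i z) (h : ∀ f ∈ U, f ∈ U') : IsChain U' i z :=
  fun S => ⟨h _ (hz S).1, (hz S).2⟩

theorem koszulD (hU : ∀ f ∈ U, ∀ j, (X j : Poly K n) • f ∈ U') (hz : IsChain U (i + 1) z) :
    IsChain U' i (koszulD K z) := by
  refine fun S => ⟨U'.sum_mem fun j _ => U'.zsmul_mem (hU _ (hz _).1 j) _, fun h => ?_⟩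
  refine Finset.sum_eq_zero fun j hj => ?_
  rw [(hz _).2, smul_zero, smul_zero]
  rw [Finset.card_insert_of_notMem (Finset.mem_compl.1 hj)]
  lia

theorem map {V : AddSubgroup T'} (φ : T →ₗ[Poly K n] T') (hφ : ∀ f ∈ U, φ f ∈ V)
    (hz : IsChain U i z) : IsChain V i fun S => φ (z S) :=
  fun S => ⟨hφ _ (hz S).1, fun h => by dsimp only; rw [(hz S).2 h, map_zero]⟩

/-- Chains lift coefficientwise along relations. -/
theorem lift {V : AddSubgroup T'} {R : Finset (Fin n) → T → T' → Prop}
    (hR : ∀ S, ∀ f ∈ U, ∃ g ∈ V, R S f g) (h0 : ∀ S, R S 0 0) (hz : IsChain U i z) :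
    ∃ y, IsChain V i y ∧ ∀ S, R S (z S) (y S) := by
  choose y hy hy' using fun S => hR S (z S) (hz S).1
  -- Lifts of zero coefficients need not vanish, so they are set to 0 outside cardinality `i`.
  refine ⟨fun S => if S.card = i then y S else 0, fun S => ⟨?_, fun h => if_neg h⟩, fun S => ?_⟩
  · dsimp only
    split_ifs
    · exact hy S
    · exact V.zero_mem
  · dsimp only
    split_ifs with h
    · exact hy' S
    · rw [(hz S).2 h]; exact h0 S

end IsChain

/-- The Koszul homology of the graded family `U` in homological degree `i` vanishes in internal
degrees greater than `r + i`. -/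
def KoszulRegular (K : Type*) [Field K] (n : ℕ) {T : Type*} [AddCommGroup T] [Module (Poly K n) T]
    (U : ℤ → AddSubgroup T) (i : ℕ) (r : ℤ) : Prop :=
  ∀ q, r < q → ∀ z : Finset (Fin n) → T, IsChain (U q) i z → koszulD K z = 0 →
    ∃ h, IsChain (U (q - 1)) (i + 1) h ∧ koszulD K h = z

theorem KoszulRegular.congr {U V : ℤ → AddSubgroup T} {i : ℕ} {r : ℤ} (h : KoszulRegular K n U i r)
    (hUV : ∀ q, r ≤ q → U q = V q) : KoszulRegular K n V i r := by
  intro q hq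
  rw [← hUV q hq.le, ← hUV (q - 1) (by lia)]
  exact h q hq

theorem koszulD_empty (z : Finset (Fin n) → T) :
    koszulD K z ∅ = ∑ j, (X j : Poly K n) • z {j} := by
  simp [koszulD, koszulSign]

/-- The chain of degree one with the given coefficients. -/
def chainOne (g : Fin n → T) (S : Finset (Fin n)) : T := ∑ j, if S = {j} then g j else 0

theorem chainOne_singleton (g : Fin n → T) (j : Fin n) : chainOne g {j} = g j := by
  simp [chainOne]

theorem isChain_chainOne {U : AddSubgroup T} {g : Fin n → T} (hg : ∀ j, g j ∈ U) :
    IsChain U 1 (chainOne g) := by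
  refine fun S => ⟨U.sum_mem fun j _ => ?_, fun h => Finset.sum_eq_zero fun j _ => if_neg ?_⟩
  · split_ifs
    · exact hg j
    · exact U.zero_mem
  · rintro rfl
    exact h (Finset.card_singleton j)

theorem koszulD_chainOne (g : Fin n → T) :
    koszulD K (chainOne g) ∅ = ∑ j, (X j : Poly K n) • g j := by
  rw [koszulD_empty]
  simp only [chainOne_singleton]

/-- The chain of degree zero with the given coefficient. -/
def chainZero (n : ℕ) (f : T) (S : Finset (Fin n)) : T := if S = ∅ then f else 0

theorem isChain_chainZero {U : AddSubgroup T} {f : T} (hf : f ∈ U) :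
    IsChain U 0 (chainZero n f) := by
  refine fun S => ⟨?_, fun h => if_neg fun h0 => h (by rw [h0, Finset.card_empty])⟩
  unfold chainZero
  split_ifs
  · exact hf
  · exact U.zero_mem

theorem koszulD_eq_zero {U : AddSubgroup T} {z : Finset (Fin n) → T} (hz : IsChain U 0 z) :
    koszulD K z = 0 := by
  funext S
  refine Finset.sum_eq_zero fun j _ => ?_
  rw [(hz _).2 (Finset.card_ne_zero_of_mem (Finset.mem_insert_self j S)), smul_zero, smul_zero]

/-- All 0-chains are cycles, so vanishing in homological degree zero is a statement about
generators. -/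
theorem koszulRegular_zero_iff {U : ℤ → AddSubgroup T} {r : ℤ} :
    KoszulRegular K n U 0 r ↔ ∀ q, r < q → ∀ f ∈ U q, ∃ g : Fin n → T,
      (∀ j, g j ∈ U (q - 1)) ∧ f = ∑ j, (X j : Poly K n) • g j := by
  constructor
  · intro h q hq f hf
    obtain ⟨y, hy, hy'⟩ := h q hq _ (isChain_chainZero (n := n) hf)
      (koszulD_eq_zero (isChain_chainZero hf))
    refine ⟨fun j => y {j}, fun j => (hy _).1, ?_⟩
    rw [← koszulD_empty, hy', chainZero, if_pos rfl]
  · intro h q hq z hz _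
    obtain ⟨g, hg, hg'⟩ := h q hq _ (hz ∅).1
    refine ⟨chainOne g, isChain_chainOne hg, ?_⟩
    funext S
    by_cases hS : S = ∅
    · rw [hS, koszulD_chainOne, hg']
    · rw [(hz S).2 (by simpa using hS)]
      refine Finset.sum_eq_zero fun j hj => ?_
      rw [((isChain_chainOne hg) _).2, smul_zero, smul_zero]
      rw [Finset.card_insert_of_notMem (Finset.mem_compl.1 hj)]
      simpa using hS

/-- A short exact sequence of graded families: regularity of the quotient. -/
theorem KoszulRegular.quotient {G Z : ℤ → AddSubgroup T} {N : ℤ → AddSubgroup T'} {i : ℕ} {r : ℤ}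
    (φ : T →ₗ[Poly K n] T') (hGN : ∀ q, r ≤ q → ∀ g ∈ G q, φ g ∈ N q)
    (hNG : ∀ q, r ≤ q → ∀ f ∈ N q, ∃ g ∈ G q, φ g = f)
    (hZ : ∀ q, r < q → ∀ g, g ∈ Z q ↔ g ∈ G q ∧ φ g = 0)
    (hX : ∀ q, ∀ g ∈ G q, ∀ j, (X j : Poly K n) • g ∈ G (q + 1))
    (hregG : KoszulRegular K n G (i + 1) r) (hregZ : KoszulRegular K n Z i (r + 1)) :
    KoszulRegular K n N (i + 1) r := by
  intro q hq z hz hdz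
  -- Chase of the connecting map: the boundary of a lift `g` of `z` is a cycle in `Z`, hence the
  -- boundary of some `h` in `Z`. Then `g - h` is a cycle in `G` that still lifts `z`.
  obtain ⟨g, hg, hgz⟩ := hz.lift (V := G q) (R := fun _ f g => φ g = f)
    (fun _ => hNG q hq.le) (fun _ => map_zero φ)
  have hmap : koszulD K (fun S => φ (g S)) = 0 := by
    rw [show (fun S => φ (g S)) = z from funext hgz, hdz]
  have hdg : IsChain (Z (q + 1)) i (GradedFree.koszulD K g) := by
    refine fun S => ⟨(hZ _ (by lia) _).2 ⟨(hg.koszulD (hX q) S).1, ?_⟩, (hg.koszulD (hX q) S).2⟩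
    rw [koszulD_map] at hmap
    exact congrFun hmap S
  obtain ⟨h, hh, hh'⟩ := hregZ (q + 1) (by lia) _ hdg (koszulD_koszulD g)
  rw [add_sub_cancel_right] at hh
  have hhZ : ∀ S, h S ∈ G q ∧ φ (h S) = 0 := fun S => (hZ _ hq _).1 (hh S).1
  obtain ⟨y, hy, hy'⟩ := hregG q hq (g - h) (hg.sub (hh.mono fun f hf => ((hZ _ hq _).1 hf).1))
    (by rw [koszulD_sub, hh', sub_self])
  refine ⟨fun S => φ (y S), hy.map φ (hGN _ (by lia)), ?_⟩
  rw [koszulD_map, hy']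
  funext S
  rw [Pi.sub_apply, map_sub, (hhZ S).2, sub_zero, hgz]

/-- A short exact sequence of graded families: regularity of the kernel. -/
theorem KoszulRegular.kernel {G Z : ℤ → AddSubgroup T} {N : ℤ → AddSubgroup T'} {i : ℕ} {r : ℤ}
    (φ : T →ₗ[Poly K n] T') (hGN : ∀ q, r ≤ q → ∀ g ∈ G q, φ g ∈ N q)
    (hNG : ∀ q, r ≤ q → ∀ f ∈ N q, ∃ g ∈ G q, φ g = f)
    (hZ : ∀ q, r < q → ∀ g, g ∈ Z q ↔ g ∈ G q ∧ φ g = 0)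
    (hX : ∀ q, ∀ g ∈ G q, ∀ j, (X j : Poly K n) • g ∈ G (q + 1))
    (hregG : KoszulRegular K n G i r) (hregN : KoszulRegular K n N (i + 1) r) :
    KoszulRegular K n Z i (r + 1) := by
  intro q hq z hz hdz
  -- In `G` the cycle `z` bounds some `g`. The image of `g` is a cycle in `N`, so it bounds; lifting
  -- that bounding chain to `y` and subtracting the boundary of `y` moves `g` into `Z` without
  -- changing its boundary.
  obtain ⟨g, hg, hg'⟩ := hregG q (by lia) z
    (hz.mono fun f hf => ((hZ _ (by lia) _).1 hf).1) hdz
  obtain ⟨h, hh, hh'⟩ := hregN (q - 1) (by lia) (fun S => φ (g S))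
    (hg.map φ (hGN _ (by lia))) (by
      rw [koszulD_map, hg']
      exact funext fun S => ((hZ _ (by lia) _).1 (hz S).1).2)
  obtain ⟨y, hy, hy'⟩ := hh.lift (V := G (q - 1 - 1)) (R := fun _ f g => φ g = f)
    (fun _ => hNG _ (by lia)) (fun _ => map_zero φ)
  have hy1 : IsChain (G (q - 1)) (i + 1) (GradedFree.koszulD K y) :=
    hy.koszulD fun f hf j => by simpa using hX _ f hf j
  have hdy : ∀ S, φ (koszulD K y S) = φ (g S) := fun S => by
    have := congrFun (koszulD_map φ y) S
    rw [← this, show (fun S => φ (y S)) = h from funext hy', hh']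
  refine ⟨g - koszulD K y, fun S => ⟨(hZ _ (by lia) _).2 ⟨((hg.sub hy1) S).1, ?_⟩,
    ((hg.sub hy1) S).2⟩, ?_⟩
  · rw [Pi.sub_apply, map_sub, hdy, sub_self]
  · rw [koszulD_sub, koszulD_koszulD, sub_zero, hg']

/-- Regularity passes to retracts. -/
theorem KoszulRegular.retract {U : ℤ → AddSubgroup T} {V : ℤ → AddSubgroup T'} {i : ℕ} {r : ℤ}
    (σ : T →ₗ[Poly K n] T') (π : T' →ₗ[Poly K n] T) (hπσ : ∀ x, π (σ x) = x)
    (hσ : ∀ q, ∀ f ∈ U q, σ f ∈ V q) (hπ : ∀ q, ∀ f ∈ V q, π f ∈ U q)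
    (hV : KoszulRegular K n V i r) : KoszulRegular K n U i r := by
  intro q hq z hz hdz
  obtain ⟨h, hh, hh'⟩ := hV q hq (fun S => σ (z S)) (hz.map σ (hσ q)) (by
    rw [koszulD_map, hdz]
    exact funext fun S => map_zero σ)
  refine ⟨fun S => π (h S), hh.map π (hπ _), ?_⟩
  rw [koszulD_map, hh']
  exact funext fun S => hπσ _

end Koszul

/-! ### A contracting homotopy for the Koszul complex of a free module. -/

section Contraction

variable {K : Type*} [Field K] {n m : ℕ}

/-- The part of a polynomial that is free of the variables `X_i`, `i < t`. -/
noncomputable def lowFree (t : ℕ) : Poly K n →ₗ[K] Poly K n :=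
  weightedHomogeneousComponent (fun i : Fin n => if (i : ℕ) < t then 1 else 0) 0

theorem coeff_lowFree (t : ℕ) (p : Poly K n) (u : Fin n →₀ ℕ)
    [Decidable (∀ i : Fin n, (i : ℕ) < t → u i = 0)] :
    coeff u (lowFree t p) = if ∀ i : Fin n, (i : ℕ) < t → u i = 0 then coeff u p else 0 := by
  rw [lowFree, coeff_weightedHomogeneousComponent]
  refine if_congr ?_ rfl rfl
  rw [Finsupp.weight_apply, Finsupp.sum_fintype _ _ (by simp)]
  simp

/-- The contraction of the part of a polynomial that is free of the variables before `X_k` with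
the variable `X_k`. -/
noncomputable def contract (k : Fin n) : Poly K n →+ Poly K n where
  toFun p := lowFree (k : ℕ) (p.divMonomial (Finsupp.single k 1))
  map_zero' := by rw [zero_divMonomial, map_zero]
  map_add' p q := by rw [add_divMonomial, map_add]

theorem coeff_contract (k : Fin n) (p : Poly K n) (u : Fin n →₀ ℕ)
    [Decidable (∀ i, i < k → u i = 0)] :
    coeff u (contract k p) =
      if ∀ i, i < k → u i = 0 then coeff (u + Finsupp.single k 1) p else 0 := by
  classical
  change coeff u (lowFree (k : ℕ) _) = _
  rw [coeff_lowFree, coeff_divMonomial, add_comm]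
  exact if_congr Iff.rfl rfl rfl

theorem contract_X_mul_self (k : Fin n) (p : Poly K n) : contract k (X k * p) = lowFree k p := by
  classical
  ext u
  rw [coeff_contract, coeff_lowFree, add_comm u, coeff_X_mul]
  exact if_congr Iff.rfl rfl rfl

theorem contract_X_mul_of_lt {i k : Fin n} (h : i < k) (p : Poly K n) :
    contract k (X i * p) = 0 := by
  classical
  ext u
  rw [coeff_contract, coeff_X_mul', coeff_zero]
  split_ifs with h1 h2
  · rw [Finsupp.mem_support_iff, Finsupp.add_apply, h1 i h, Finsupp.single_eq_of_ne h.ne] at h2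
    exact absurd rfl h2
  · rfl
  · rfl

theorem contract_X_mul_of_gt {i k : Fin n} (h : k < i) (p : Poly K n) :
    contract k (X i * p) = X i * contract k p := by
  classical
  ext u
  rw [coeff_contract, coeff_X_mul', coeff_X_mul', coeff_contract]
  by_cases hi : i ∈ u.support
  · have hi' : i ∈ (u + Finsupp.single k 1).support := by
      rw [Finsupp.mem_support_iff] at hi ⊢
      simp [hi]
    rw [if_pos hi, if_pos hi']
    have hu : Finsupp.single i 1 ≤ u := by
      rw [Finsupp.single_le_iff]
      exact Nat.one_le_iff_ne_zero.2 (Finsupp.mem_support_iff.1 hi)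
    refine if_congr (forall₂_congr fun j hj => ?_) ?_ rfl
    · rw [Finsupp.tsub_apply, Finsupp.single_eq_of_ne (hj.trans h).ne, tsub_zero]
    · rw [tsub_add_eq_add_tsub hu]
  · have hi' : i ∉ (u + Finsupp.single k 1).support := by
      rw [Finsupp.notMem_support_iff] at hi ⊢
      simp [hi, Finsupp.single_eq_of_ne h.ne']
    rw [if_neg hi, if_neg hi', ite_self]

/-- Among the monomials free of the variables before `X k`, the contraction keeps those divisible by
`X k`. Summed over `k` the right-hand sides telescope. -/
theorem X_mul_contract (k : Fin n) (p : Poly K n) :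
    X k * contract k p = lowFree k p - lowFree (k + 1) p := by
  classical
  ext u
  rw [coeff_X_mul', coeff_contract, coeff_sub, coeff_lowFree, coeff_lowFree]
  by_cases hk : k ∈ u.support
  · have hu : Finsupp.single k 1 ≤ u := by
      rw [Finsupp.single_le_iff]
      exact Nat.one_le_iff_ne_zero.2 (Finsupp.mem_support_iff.1 hk)
    have h2 : ¬ ∀ i : Fin n, (i : ℕ) < k + 1 → u i = 0 := fun h =>
      (Finsupp.mem_support_iff.1 hk) (h k (Nat.lt_succ_self _))
    rw [if_pos hk, if_neg h2, sub_zero, tsub_add_cancel_of_le hu]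
    refine if_congr (forall₂_congr fun j hj => ?_) rfl rfl
    rw [Finsupp.tsub_apply, Finsupp.single_eq_of_ne (ne_of_lt hj), tsub_zero]
  · rw [if_neg hk, eq_comm, sub_eq_zero]
    refine if_congr ⟨fun h i hi => ?_, fun h i hi => h i (by lia)⟩ rfl rfl
    rcases Nat.lt_succ_iff_lt_or_eq.1 hi with hi | hi
    · exact h i hi
    · rw [Fin.ext hi]; exact Finsupp.notMem_support_iff.1 hk

theorem lowFree_zero (p : Poly K n) : lowFree 0 p = p := by
  classical
  ext u
  rw [coeff_lowFree, if_pos (by simp)]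

theorem lowFree_top {p : Poly K n} (hp : coeff 0 p = 0) : lowFree n p = 0 := by
  classical
  ext u
  rw [coeff_lowFree, coeff_zero]
  split_ifs with h
  · rw [show u = 0 from Finsupp.ext fun i => h i i.2, hp]
  · rfl

theorem sum_X_mul_contract_lt (t : ℕ) (ht : t ≤ n) (p : Poly K n) :
    ∑ k ∈ Finset.univ.filter (fun k : Fin n => (k : ℕ) < t), X k * contract k p =
      p - lowFree t p := by
  induction t with
  | zero => simp [lowFree_zero]
  | succ t ih =>
    have hs : (Finset.univ.filter fun k : Fin n => (k : ℕ) < t + 1) =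
        insert ⟨t, ht⟩ (Finset.univ.filter fun k : Fin n => (k : ℕ) < t) := by
      ext k
      simp only [Finset.mem_filter, Finset.mem_univ, true_and, Finset.mem_insert, Fin.ext_iff]
      lia
    rw [hs, Finset.sum_insert (by simp), ih (by lia), X_mul_contract]
    simp

/-- Each nonconstant monomial is recovered exactly once, from the first variable that divides it. -/
theorem sum_X_mul_contract {p : Poly K n} (hp : coeff 0 p = 0) :
    ∑ k : Fin n, X k * contract k p = p := by
  have := sum_X_mul_contract_lt n le_rfl p
  rwa [lowFree_top hp, sub_zero, Finset.filter_true_of_mem (fun k _ => k.2)] at this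

/-- Coordinatewise contraction. -/
noncomputable def contractFree (k : Fin n) (f : Fin m → Poly K n) : Fin m → Poly K n :=
  fun l => contract k (f l)

theorem contractFree_eq {d : Fin m → ℤ} {q : ℤ} {f : Fin m → Poly K n} (hf : wcomp 1 d q f = f)
    (k : Fin n) : wcomp 1 d (q - 1) (contractFree k f) = contractFree k f := by
  classical
  refine ext_coeff fun l u => ?_
  rw [coeff_wcomp, contractFree, coeff_contract]
  have h := wt_add_single 1 d l u k
  have h' := coeff_wcomp 1 d q f l (u + Finsupp.single k 1)
  rw [hf, h] at h'
  simp only [Pi.one_apply, Nat.cast_one] at h'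
  by_cases hq : wt 1 d l u = q - 1
  · rw [if_pos hq]
  · rw [if_neg hq]
    rw [if_neg (by lia)] at h'
    rw [h', ite_self]

theorem sum_X_smul_contractFree {f : Fin m → Poly K n} (hf : ∀ l, coeff 0 (f l) = 0) :
    ∑ k, (X k : Poly K n) • contractFree k f = f := by
  funext l
  rw [Finset.sum_apply]
  exact sum_X_mul_contract (hf l)

theorem mem_maxIdeal_smul_top_iff {f : Fin m → Poly K n} :
    f ∈ maxIdeal K n • (⊤ : Submodule (Poly K n) (Fin m → Poly K n)) ↔ ∀ l, coeff 0 (f l) = 0 := by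
  constructor
  · intro hf l
    refine Submodule.smul_induction_on (p := fun f => coeff 0 (f l) = 0) hf ?_ ?_
    · intro p hp g _
      have hp0 : constantCoeff p = 0 := by
        have : maxIdeal K n ≤ RingHom.ker (constantCoeff : Poly K n →+* K) := by
          refine Ideal.span_le.2 ?_
          rintro _ ⟨i, rfl⟩
          simp
        exact this hp
      change constantCoeff (p * g l) = 0
      rw [map_mul, hp0, zero_mul]
    · intro x y hx hy
      rw [Pi.add_apply, coeff_add, hx, hy, add_zero]
  · intro hf
    rw [← sum_X_smul_contractFree hf]
    exact Submodule.sum_mem _ fun k _ =>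
      Submodule.smul_mem_smul (Ideal.subset_span ⟨k, rfl⟩) Submodule.mem_top

/-- The contracting homotopy of the Koszul complex of a free module. -/
noncomputable def koszulH (z : Finset (Fin n) → Poly K n) (S : Finset (Fin n)) : Poly K n :=
  if h : S.Nonempty then contract (S.min' h) (z (S.erase (S.min' h))) else 0

theorem koszulH_insert (z : Finset (Fin n) → Poly K n) {j : Fin n} {S : Finset (Fin n)}
    (h : ∀ s ∈ S, j < s) : koszulH z (insert j S) = contract j (z S) := by
  have hmin : (insert j S).min' (Finset.insert_nonempty j S) = j := by
    refine le_antisymm (Finset.min'_le _ _ (Finset.mem_insert_self j S)) (Finset.le_min' _ _ _ ?_)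
    intro s hs
    rcases Finset.mem_insert.1 hs with rfl | hs
    · exact le_rfl
    · exact (h s hs).le
  rw [koszulH, dif_pos (Finset.insert_nonempty j S), hmin,
    Finset.erase_insert fun hj => (h j hj).false]

/-- Let j be the least element of S. In the boundary at S, the summands with k < j reproduce the
monomials of `z S` that involve a variable before X_j. The summands with k > j give the remaining
monomials, by the cycle equation at S \ {j}. -/
theorem koszulD_koszulH {z : Finset (Fin n) → Poly K n} (hz : koszulD K z = 0)
    (h0 : coeff 0 (z ∅) = 0) : koszulD K (koszulH z) = z := by
  classical
  funext S
  rcases S.eq_empty_or_nonempty with rfl | hS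
  · rw [koszulD_empty]
    refine (Finset.sum_congr rfl fun k _ => ?_).trans (sum_X_mul_contract h0)
    rw [← insert_empty_eq, koszulH_insert z (by simp), smul_eq_mul]
  · obtain ⟨j, S₀, hj, rfl⟩ : ∃ j S₀, (∀ s ∈ S₀, j < s) ∧ S = insert j S₀ := by
      refine ⟨S.min' hS, S.erase (S.min' hS), fun s hs => ?_, (Finset.insert_erase (S.min'_mem hS)).symm⟩
      exact Finset.min'_lt_of_mem_erase_min' _ _ hs
    have hjS : j ∉ S₀ := fun h => (hj j h).false
    have hlow : ∀ k ∈ (insert j S₀)ᶜ, k < j →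
        koszulSign k (insert j S₀) • ((X k : Poly K n) • koszulH z (insert k (insert j S₀))) =
          X k * contract k (z (insert j S₀)) := by
      intro k _ hkj
      have : ∀ s ∈ insert j S₀, k < s := by
        intro s hs
        rcases Finset.mem_insert.1 hs with rfl | hs
        · exact hkj
        · exact hkj.trans (hj s hs)
      rw [koszulSign_of_lt this, koszulH_insert z this, one_smul, smul_eq_mul]
    have hhigh : ∀ k ∈ (insert j S₀)ᶜ, ¬ k < j →
        koszulSign k (insert j S₀) • ((X k : Poly K n) • koszulH z (insert k (insert j S₀))) =
          -contract j (koszulSign k S₀ • ((X k : Poly K n) • z (insert k S₀))) := by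
      intro k hk hkj
      rw [Finset.mem_compl, Finset.mem_insert, not_or] at hk
      have hjk : j < k := lt_of_le_of_ne (not_lt.1 hkj) (Ne.symm hk.1)
      have : ∀ s ∈ insert k S₀, j < s := by
        intro s hs
        rcases Finset.mem_insert.1 hs with rfl | hs
        · exact hjk
        · exact hj s hs
      rw [Finset.insert_comm, koszulH_insert z this, koszulSign_insert _ _ hjS, if_pos hjk,
        map_zsmul, smul_eq_mul, smul_eq_mul, contract_X_mul_of_gt hjk, neg_one_mul, neg_smul]
    -- In the contracted cycle equation at S₀ the term k = j is the part of `z (insert j S₀)` free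
    -- of earlier variables, the terms with k < j vanish, and those with k > j are the negatives of
    -- the summands in `hhigh`.
    have hcyc : contract j (koszulD K z S₀) = 0 := by rw [hz, Pi.zero_apply, map_zero]
    have hS₀ : S₀ᶜ = insert j (insert j S₀)ᶜ := by
      ext k
      simp only [Finset.mem_compl, Finset.mem_insert, not_or]
      by_cases hk : k = j
      · simp [hk, hjS]
      · simp [hk]
    rw [koszulD, hS₀, Finset.sum_insert (by simp), map_add, koszulSign_of_lt hj, one_smul,
      smul_eq_mul, contract_X_mul_self, map_sum,
      ← Finset.sum_filter_add_sum_filter_not _ (fun k => k < j)] at hcyc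
    have hzero : ∑ k ∈ (insert j S₀)ᶜ with k < j,
        contract j (koszulSign k S₀ • ((X k : Poly K n) • z (insert k S₀))) = 0 := by
      refine Finset.sum_eq_zero fun k hk => ?_
      rw [map_zsmul, smul_eq_mul, contract_X_mul_of_lt (Finset.mem_filter.1 hk).2, smul_zero]
    rw [hzero, zero_add] at hcyc
    rw [koszulD, ← Finset.sum_filter_add_sum_filter_not _ (fun k => k < j),
      Finset.sum_congr rfl fun k hk =>
        hlow k (Finset.mem_filter.1 hk).1 (Finset.mem_filter.1 hk).2,
      Finset.sum_congr rfl fun k hk =>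
        hhigh k (Finset.mem_filter.1 hk).1 (Finset.mem_filter.1 hk).2,
      Finset.sum_neg_distrib, eq_neg_of_add_eq_zero_right hcyc, neg_neg]
    have hfilter : (insert j S₀)ᶜ.filter (fun k => k < j) =
        Finset.univ.filter (fun k : Fin n => (k : ℕ) < j) := by
      ext k
      simp only [Finset.mem_filter, Finset.mem_compl, Finset.mem_insert, not_or, Finset.mem_univ,
        true_and, Fin.lt_def]
      refine ⟨fun h => h.2, fun h => ⟨⟨fun hk => ?_, fun hk => ?_⟩, h⟩⟩
      · rw [hk] at h; exact h.false
      · exact (h.trans (Fin.lt_def.1 (hj k hk))).false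
    rw [hfilter, sum_X_mul_contract_lt j j.2.le, sub_add_cancel]

/-- The elements of degree `q` of the free module generated by the basis elements of degree at
most `b`. -/
noncomputable def freePiece (K : Type*) [Field K] (n : ℕ) (d : Fin m → ℤ) (b q : ℤ) :
    AddSubgroup (Fin m → Poly K n) where
  carrier := {f | wcomp 1 d q f = f ∧ ∀ l, b < d l → f l = 0}
  zero_mem' := ⟨map_zero _, fun _ _ => rfl⟩
  add_mem' := fun ha hb => ⟨by rw [map_add, ha.1, hb.1], fun l hl => by
    rw [Pi.add_apply, ha.2 l hl, hb.2 l hl, add_zero]⟩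
  neg_mem' := fun ha => ⟨by rw [map_neg, ha.1], fun l hl => by
    rw [Pi.neg_apply, ha.2 l hl, neg_zero]⟩

theorem mem_freePiece {d : Fin m → ℤ} {b q : ℤ} {f : Fin m → Poly K n} :
    f ∈ freePiece K n d b q ↔ wcomp 1 d q f = f ∧ ∀ l, b < d l → f l = 0 := Iff.rfl

theorem X_smul_mem_freePiece {d : Fin m → ℤ} {b q : ℤ} {f : Fin m → Poly K n}
    (hf : f ∈ freePiece K n d b q) (i : Fin n) :
    (X i : Poly K n) • f ∈ freePiece K n d b (q + 1) :=
  ⟨X_smul_eq hf.1 i, fun l hl => by rw [Pi.smul_apply, hf.2 l hl, smul_zero]⟩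

theorem contractFree_mem_freePiece {d : Fin m → ℤ} {b q : ℤ} {f : Fin m → Poly K n}
    (hf : f ∈ freePiece K n d b q) (i : Fin n) :
    contractFree i f ∈ freePiece K n d b (q - 1) :=
  ⟨contractFree_eq hf.1 i, fun l hl => by rw [contractFree, hf.2 l hl, map_zero]⟩

theorem coeff_zero_of_ne {d : Fin m → ℤ} {q : ℤ} {f : Fin m → Poly K n} (hf : wcomp 1 d q f = f)
    {l : Fin m} (hl : d l ≠ q) : coeff 0 (f l) = 0 := by
  rw [← hf, coeff_wcomp, if_neg]
  simpa [wt] using hl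

theorem coeff_zero_of_mem_freePiece {d : Fin m → ℤ} {b q : ℤ} (hq : b < q) {f : Fin m → Poly K n}
    (hf : f ∈ freePiece K n d b q) (l : Fin m) : coeff 0 (f l) = 0 := by
  by_cases hl : b < d l
  · rw [hf.2 l hl, coeff_zero]
  · exact coeff_zero_of_ne hf.1 (by lia)

/-- The homotopy is applied coordinatewise. Its only obstruction is a constant term, and constant
terms occur only in the degrees of the basis elements, which are at most `b`. -/
theorem koszulRegular_freePiece (d : Fin m → ℤ) (b : ℤ) (i : ℕ) :
    KoszulRegular K n (freePiece K n d b) i b := by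
  intro q hq z hz hdz
  refine ⟨fun S l => koszulH (fun S' => z S' l) S, fun S => ⟨?_, fun hS => ?_⟩, ?_⟩
  · by_cases h : S.Nonempty
    · have : (fun l => koszulH (fun S' => z S' l) S) =
          contractFree (S.min' h) (z (S.erase (S.min' h))) := by
        funext l
        rw [koszulH, dif_pos h, contractFree]
      dsimp only
      rw [this]
      exact contractFree_mem_freePiece (hz _).1 _
    · have : (fun l => koszulH (fun S' => z S' l) S) = 0 := by
        funext l
        rw [koszulH, dif_neg h, Pi.zero_apply]
      dsimp only
      rw [this]
      exact AddSubgroup.zero_mem _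
  · funext l
    change koszulH (fun S' => z S' l) S = 0
    rw [koszulH]
    split_ifs with h
    · have hcard : (S.erase (S.min' h)).card ≠ i := by
        rw [Finset.card_erase_of_mem (S.min'_mem h)]
        have := h.card_pos
        lia
      rw [(hz _).2 hcard, Pi.zero_apply, map_zero]
    · rfl
  · funext S l
    have h1 : ∀ y : Finset (Fin n) → Fin m → Poly K n, ∀ S,
        koszulD K y S l = koszulD K (fun S' => y S' l) S := fun y S => by
      simp only [koszulD, Finset.sum_apply, Pi.smul_apply]
    rw [h1]
    refine congrFun (koszulD_koszulH ?_ ?_) S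
    · funext S
      rw [← h1, hdz]; rfl
    · exact coeff_zero_of_mem_freePiece hq (hz ∅).1 l

theorem piece_top_eq {d : Fin m → ℤ} {b : ℤ} (hd : ∀ l, d l ≤ b) (q : ℤ) :
    piece d (⊤ : Submodule (Poly K n) _) q = freePiece K n d b q := by
  ext f
  rw [mem_piece, mem_freePiece]
  exact ⟨fun h => ⟨h.2, fun l hl => absurd hl (not_lt.2 (hd l))⟩, fun h => ⟨trivial, h.1⟩⟩

end Contraction

/-! ### Minimal generators, graded lifts and retractions of free modules. -/

section Free

variable {K : Type*} [Field K] {n m r s : ℕ}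

theorem linearCombination_single (g : Fin r → Fin m → Poly K n) (l : Fin r) :
    Fintype.linearCombination (Poly K n) g (Pi.single l 1) = g l := by
  rw [Fintype.linearCombination_apply_single, one_smul]

theorem preserves_linearCombination {c : Fin n → ℕ} {e : Fin r → ℤ} {e' : Fin m → ℤ}
    {g : Fin r → Fin m → Poly K n} (hg : ∀ l, wcomp c e' (e l) (g l) = g l) :
    Preserves c e e' (Fintype.linearCombination (Poly K n) g) :=
  preserves_of_basis fun l => by rw [linearCombination_single, hg]

/-- Every set of homogeneous generators contains a minimal system of generators. -/
theorem exists_minimal_generators {d : Fin m → ℤ} {B : Set (Fin m → Poly K n)}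
    (hB : ∀ f ∈ B, ∃ k, wcomp 1 d k f = f) :
    ∃ (r : ℕ) (g : Fin r → Fin m → Poly K n), (∀ l, g l ∈ B) ∧
      LinearMap.range (Fintype.linearCombination (Poly K n) g) = Submodule.span (Poly K n) B ∧
      LinearMap.ker (Fintype.linearCombination (Poly K n) g) ≤ maxIdeal K n • ⊤ := by
  classical
  -- A generating family of least length is taken among those with members in `B`; thus generators
  -- can be homogeneous for degree and weight at once.
  have hex : ∃ (r : ℕ) (g : Fin r → Fin m → Poly K n), (∀ l, g l ∈ B) ∧
      LinearMap.range (Fintype.linearCombination (Poly K n) g) = Submodule.span (Poly K n) B := by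
    obtain ⟨t, htB, ht⟩ := (Submodule.fg_span_iff_fg_span_finset_subset B).1
      (IsNoetherian.noetherian (Submodule.span (Poly K n) B))
    refine ⟨t.card, fun l => (t.equivFin.symm l : Fin m → Poly K n),
      fun l => htB (t.equivFin.symm l).2, ?_⟩
    rw [Fintype.range_linearCombination, ht]
    congr 1
    ext f
    constructor
    · rintro ⟨l, rfl⟩
      exact (t.equivFin.symm l).2
    · intro hf
      exact ⟨t.equivFin ⟨f, hf⟩, by simp⟩
  obtain ⟨g, hgB, hg⟩ := Nat.find_spec hex
  have hmin := fun {q} => @Nat.find_min _ _ hex q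
  generalize Nat.find hex = r at g hgB hg hmin
  refine ⟨r, g, hgB, hg, fun y hy => ?_⟩
  rw [mem_maxIdeal_smul_top_iff]
  by_contra! hl
  obtain ⟨l, hl⟩ := hl
  choose e he using fun l => hB (g l) (hgB l)
  obtain ⟨r, rfl⟩ : ∃ r', r = r' + 1 := ⟨r - 1, by have := l.2; lia⟩
  -- The component of degree `e l` of the relation is again a relation, and its `l`-th coordinate is
  -- a nonzero constant. Hence `g l` is redundant, against minimality.
  have hy' := (preserves_linearCombination (c := 1) he).ker_mem hy (e l)
  set y' := wcomp 1 e (e l) y with hy'def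
  have hyl : y' l = C (coeff 0 (y l)) := by
    ext u
    rw [hy'def, coeff_wcomp, coeff_C]
    by_cases hu : u = 0
    · subst hu; simp [wt]
    · rw [if_neg (Ne.symm hu), if_neg]
      intro h
      refine hu (Finsupp.ext fun i => ?_)
      simp only [wt, Pi.one_apply, one_mul, add_eq_right, Nat.cast_eq_zero,
        Finset.sum_eq_zero_iff] at h
      exact h i (Finset.mem_univ _)
  refine hmin (Nat.lt_succ_self r) ⟨fun i => g (l.succAbove i), fun i => hgB _, ?_⟩
  rw [← hg, Fintype.range_linearCombination, Fintype.range_linearCombination]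
  refine le_antisymm (Submodule.span_mono ?_) (Submodule.span_le.2 ?_)
  · rintro _ ⟨i, rfl⟩
    exact ⟨_, rfl⟩
  · rintro _ ⟨l', rfl⟩
    rcases Fin.eq_self_or_eq_succAbove l l' with rfl | ⟨i, rfl⟩
    · rw [LinearMap.mem_ker, Fintype.linearCombination_apply, Fin.sum_univ_succAbove _ l', hyl] at hy'
      have h1 : g l' = (C (coeff 0 (y l'))⁻¹ : Poly K n) •
          -∑ i, y' (l'.succAbove i) • g (l'.succAbove i) := by
        rw [← eq_neg_of_add_eq_zero_left hy', smul_smul, ← C_mul, inv_mul_cancel₀ hl, C_1, one_smul]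
      rw [h1]
      exact Submodule.smul_mem _ _ (Submodule.neg_mem _ (Submodule.sum_mem _ fun i _ =>
        Submodule.smul_mem _ _ (Submodule.subset_span ⟨i, rfl⟩)))
    · exact Submodule.subset_span ⟨i, rfl⟩

theorem exists_graded_preimage {d : Fin m → ℤ} {b : Fin r → ℤ}
    {φ : (Fin r → Poly K n) →ₗ[Poly K n] (Fin m → Poly K n)} (hφ : Preserves 1 b d φ)
    {f : Fin m → Poly K n} (hf : f ∈ LinearMap.range φ) {q : ℤ} (hq : wcomp 1 d q f = f) :
    ∃ g, wcomp 1 b q g = g ∧ φ g = f := by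
  obtain ⟨g, rfl⟩ := hf
  exact ⟨wcomp 1 b q g, wcomp_self _ _ _ _, by rw [hφ, hq]⟩

/-- Graded maps from free modules lift along graded maps. -/
theorem exists_graded_lift {d : Fin m → ℤ} {b : Fin r → ℤ} {b' : Fin s → ℤ}
    {φ : (Fin r → Poly K n) →ₗ[Poly K n] (Fin m → Poly K n)} (hφ : Preserves 1 b d φ)
    {ψ : (Fin s → Poly K n) →ₗ[Poly K n] (Fin m → Poly K n)} (hψ : Preserves 1 b' d ψ)
    (h : LinearMap.range ψ ≤ LinearMap.range φ) :
    ∃ σ : (Fin s → Poly K n) →ₗ[Poly K n] (Fin r → Poly K n),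
      Preserves 1 b' b σ ∧ ∀ x, φ (σ x) = ψ x := by
  choose g hg hg' using fun l => exists_graded_preimage hφ (h ⟨Pi.single l 1, rfl⟩)
    (hψ.map_eq (by rw [wcomp_single, if_pos rfl] : wcomp 1 b' (b' l) (Pi.single l 1) = Pi.single l 1))
  refine ⟨Fintype.linearCombination (Poly K n) g, preserves_linearCombination hg, fun x => ?_⟩
  rw [Fintype.linearCombination_apply, map_sum]
  conv_rhs => rw [pi_eq_sum_univ' x, map_sum]
  simp only [map_smul, hg']

/-- A graded endomorphism of a free module which is the identity modulo the maximal ideal is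
bijective. -/
theorem bijective_of_sub_mem {b : Fin r → ℤ}
    {θ : (Fin r → Poly K n) →ₗ[Poly K n] (Fin r → Poly K n)} (hθ : Preserves 1 b b θ)
    (h : ∀ x, θ x - x ∈ maxIdeal K n • (⊤ : Submodule (Poly K n) (Fin r → Poly K n))) :
    Function.Bijective θ := by
  suffices hs : Function.Surjective θ from
    ⟨OrzechProperty.injective_of_surjective_endomorphism θ hs, hs⟩
  obtain ⟨B, hB⟩ : ∃ B, ∀ l, B ≤ b l := by
    obtain ⟨B, hB⟩ := (Set.finite_range b).bddBelow
    exact ⟨B, fun l => hB ⟨l, rfl⟩⟩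
  -- Graded Nakayama by induction on the degree: `θ y - y` is a combination of variables times
  -- elements of degree one less.
  have key : ∀ (t : ℕ) (q : ℤ), q < B + t → ∀ y, wcomp 1 b q y = y → y ∈ LinearMap.range θ := by
    intro t
    induction t with
    | zero =>
      intro q hq y hy
      rw [← hy, wcomp_eq_zero_of_lt hB (by simpa using hq)]
      exact Submodule.zero_mem _
    | succ t ih =>
      intro q hq y hy
      have h1 : wcomp 1 b q (θ y - y) = θ y - y := by rw [map_sub, hθ.map_eq hy, hy]
      have h2 : θ y - y ∈ LinearMap.range θ := by
        rw [← sum_X_smul_contractFree (mem_maxIdeal_smul_top_iff.1 (h y))]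
        exact Submodule.sum_mem _ fun k _ => Submodule.smul_mem _ _
          (ih (q - 1) (by push_cast at hq; lia) _ (contractFree_eq h1 k))
      have := Submodule.sub_mem _ (⟨y, rfl⟩ : θ y ∈ LinearMap.range θ) h2
      rwa [sub_sub_cancel] at this
  intro y
  refine mem_of_wcomp_mem (N := LinearMap.range θ) (c := 1) (e := b) fun q => ?_
  exact key (q - B + 1).toNat q (by lia) _ (wcomp_self _ _ _ _)

/-- A retraction between graded modules lifts to a retraction of graded free covers if the cover of
the retract is minimal. -/
theorem exists_retraction_lift {m₁ r₁ : ℕ} {d₁ : Fin m₁ → ℤ} {d : Fin m → ℤ} {b₁ : Fin r₁ → ℤ}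
    {b : Fin r → ℤ}
    {σ : (Fin m₁ → Poly K n) →ₗ[Poly K n] (Fin m → Poly K n)} (hσ : Preserves 1 d₁ d σ)
    {π : (Fin m → Poly K n) →ₗ[Poly K n] (Fin m₁ → Poly K n)} (hπ : Preserves 1 d d₁ π)
    (hπσ : ∀ x, π (σ x) = x)
    {φ₁ : (Fin r₁ → Poly K n) →ₗ[Poly K n] (Fin m₁ → Poly K n)} (hφ₁ : Preserves 1 b₁ d₁ φ₁)
    (hmin : LinearMap.ker φ₁ ≤ maxIdeal K n • ⊤)
    {φ : (Fin r → Poly K n) →ₗ[Poly K n] (Fin m → Poly K n)} (hφ : Preserves 1 b d φ)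
    (hσr : ∀ x ∈ LinearMap.range φ₁, σ x ∈ LinearMap.range φ)
    (hπr : ∀ x ∈ LinearMap.range φ, π x ∈ LinearMap.range φ₁) :
    ∃ (σ' : (Fin r₁ → Poly K n) →ₗ[Poly K n] (Fin r → Poly K n))
      (π' : (Fin r → Poly K n) →ₗ[Poly K n] (Fin r₁ → Poly K n)),
      Preserves 1 b₁ b σ' ∧ Preserves 1 b b₁ π' ∧ (∀ x, π' (σ' x) = x) ∧
      (∀ x, φ (σ' x) = σ (φ₁ x)) ∧ ∀ x, φ₁ (π' x) = π (φ x) := by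
  obtain ⟨σ', hσ', hσφ⟩ := exists_graded_lift hφ (hσ.comp hφ₁) (by
    rintro _ ⟨x, rfl⟩; exact hσr _ ⟨x, rfl⟩)
  obtain ⟨π₀, hπ₀, hπφ⟩ := exists_graded_lift hφ₁ (hπ.comp hφ) (by
    rintro _ ⟨x, rfl⟩; exact hπr _ ⟨x, rfl⟩)
  simp only [LinearMap.comp_apply] at hσφ hπφ
  have hθ := hπ₀.comp hσ'
  -- The composite `π₀ ∘ₗ σ'` covers the identity, so it differs from the identity by elements of
  -- `ker φ₁`, and minimality makes it an automorphism `θ`. Composing `π₀` with the inverse of `θ`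
  -- gives a true retraction; since `φ₁` absorbs `θ`, compatibility with `π` survives.
  have hbij := bijective_of_sub_mem hθ fun x => hmin (by
    rw [LinearMap.mem_ker, map_sub, LinearMap.comp_apply, hπφ, hσφ, hπσ, sub_self])
  set θ := LinearEquiv.ofBijective (π₀ ∘ₗ σ') hbij with hθdef
  have hθapp : ∀ x, θ x = π₀ (σ' x) := fun x => rfl
  have hsymm : ∀ k x, θ.symm (wcomp 1 b₁ k x) = wcomp 1 b₁ k (θ.symm x) := fun k x => by
    rw [LinearEquiv.symm_apply_eq, hθapp]
    have := hθ k (θ.symm x)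
    rw [LinearMap.comp_apply, LinearMap.comp_apply, ← hθapp (θ.symm x), θ.apply_symm_apply] at this
    exact this.symm
  have hφθ : ∀ x, φ₁ (θ.symm x) = φ₁ x := fun x => by
    conv_rhs => rw [← θ.apply_symm_apply x, hθapp, hπφ, hσφ, hπσ]
  refine ⟨σ', θ.symm.toLinearMap ∘ₗ π₀, hσ', fun k g => ?_, fun x => ?_, hσφ, fun x => ?_⟩
  · rw [LinearMap.comp_apply, LinearMap.comp_apply, hπ₀]
    exact hsymm _ _
  · rw [LinearMap.comp_apply, ← hθapp]
    exact θ.symm_apply_apply x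
  · rw [LinearMap.comp_apply]
    exact (hφθ _).trans (hπφ x)

/-- A retraction between free modules of the same rank is an isomorphism. -/
theorem right_inverse_of_rank_eq {r₁ : ℕ} (h : r₁ = r)
    {σ : (Fin r₁ → Poly K n) →ₗ[Poly K n] (Fin r → Poly K n)}
    {π : (Fin r → Poly K n) →ₗ[Poly K n] (Fin r₁ → Poly K n)} (hπσ : ∀ x, π (σ x) = x)
    (y : Fin r → Poly K n) : σ (π y) = y := by
  subst h
  exact OrzechProperty.injective_of_surjective_endomorphism π
    (fun x => ⟨σ x, hπσ x⟩) (hπσ _)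

theorem rank_le_of_retraction {r₁ : ℕ}
    {σ : (Fin r₁ → Poly K n) →ₗ[Poly K n] (Fin r → Poly K n)}
    {π : (Fin r → Poly K n) →ₗ[Poly K n] (Fin r₁ → Poly K n)} (hπσ : ∀ x, π (σ x) = x) : r₁ ≤ r :=
  le_of_fin_surjective (Poly K n) π fun x => ⟨σ x, hπσ x⟩

end Free

/-! ### Minimal resolutions, Betti numbers, and regularity through Koszul homology. -/

section Resolutions

variable {K : Type*} [Field K] {n m r : ℕ}

namespace MinimalResolution

variable {d : Fin m → ℤ} {N : Submodule (Poly K n) (Fin m → Poly K n)}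

theorem preserves_aug (P : MinimalResolution d N) : Preserves 1 (P.deg 0) d P.aug :=
  isHomogeneous_preserves_iff.1 P.aug_homogeneous

theorem ker_aug_le (P : MinimalResolution d N) : LinearMap.ker P.aug ≤ maxIdeal K n • ⊤ :=
  P.exact_zero ▸ P.minimal 0

/-- The resolution of the first syzygy module. -/
noncomputable def shift (P : MinimalResolution d N) :
    MinimalResolution (P.deg 0) (LinearMap.ker P.aug) where
  rank i := P.rank (i + 1)
  deg i := P.deg (i + 1)
  aug := P.diff 0
  diff i := P.diff (i + 1)
  aug_homogeneous := P.diff_homogeneous 0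
  diff_homogeneous i := P.diff_homogeneous (i + 1)
  range_aug := P.exact_zero
  exact_zero := P.exact_succ 0
  exact_succ i := P.exact_succ (i + 1)
  minimal i := P.minimal (i + 1)

/-- A resolution of the kernel of a minimal free cover gives a resolution. -/
noncomputable def cons {b : Fin r → ℤ} {φ : (Fin r → Poly K n) →ₗ[Poly K n] (Fin m → Poly K n)}
    (hφ : Preserves 1 b d φ) (hrange : LinearMap.range φ = N)
    (hker : LinearMap.ker φ ≤ maxIdeal K n • ⊤) (P : MinimalResolution b (LinearMap.ker φ)) :
    MinimalResolution d N where
  rank | 0 => r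
       | i + 1 => P.rank i
  deg | 0 => b
      | i + 1 => P.deg i
  aug := φ
  diff | 0 => P.aug
       | i + 1 => P.diff i
  aug_homogeneous := isHomogeneous_preserves_iff.2 hφ
  diff_homogeneous | 0 => P.aug_homogeneous
                   | i + 1 => P.diff_homogeneous i
  range_aug := hrange
  exact_zero := P.range_aug
  exact_succ | 0 => P.exact_zero
             | i + 1 => P.exact_succ i
  minimal | 0 => P.range_aug.trans_le hker
          | i + 1 => P.minimal i

end MinimalResolution

/-- Iterating minimal free covers yields a minimal free resolution. -/
theorem exists_minimalResolution_of_step (Inv : ℕ → SubmoduleOfFree K n → Prop)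
    (D : ℕ → ℤ → Prop)
    (step : ∀ k S, Inv k S → ∃ (r : ℕ) (b : Fin r → ℤ)
      (φ : (Fin r → Poly K n) →ₗ[Poly K n] (Fin S.rank → Poly K n)),
      Preserves 1 b S.deg φ ∧ LinearMap.range φ = S.carrier ∧
      LinearMap.ker φ ≤ maxIdeal K n • ⊤ ∧ (∀ l, D k (b l)) ∧ Inv (k + 1) ⟨r, b, LinearMap.ker φ⟩)
    (d : Fin m → ℤ) (N : Submodule (Poly K n) (Fin m → Poly K n)) (h0 : Inv 0 ⟨m, d, N⟩) :
    ∃ P : MinimalResolution d N, ∀ k l, D k (P.deg k l) := by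
  -- Bundling each kernel with its invariant lets the chosen step be iterated by `Nat.rec`; the
  -- equation for the carrier then provides exactness.
  have step' : ∀ (k : ℕ) (S : {S // Inv k S}), ∃ (S' : {S' // Inv (k + 1) S'})
      (φ : (Fin S'.1.rank → Poly K n) →ₗ[Poly K n] (Fin S.1.rank → Poly K n)),
      Preserves 1 S'.1.deg S.1.deg φ ∧ LinearMap.range φ = S.1.carrier ∧
      LinearMap.ker φ ≤ maxIdeal K n • ⊤ ∧ (∀ l, D k (S'.1.deg l)) ∧
      S'.1.carrier = LinearMap.ker φ := by
    rintro k ⟨S, hS⟩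
    obtain ⟨r, b, φ, h1, h2, h3, h4, h5⟩ := step k S hS
    exact ⟨⟨⟨r, b, LinearMap.ker φ⟩, h5⟩, φ, h1, h2, h3, h4, rfl⟩
  choose next φ h1 h2 h3 h4 h5 using step'
  let seq : (k : ℕ) → {S // Inv k S} := fun k => Nat.rec ⟨⟨m, d, N⟩, h0⟩ next k
  refine ⟨{ rank := fun i => (seq (i + 1)).1.rank
            deg := fun i => (seq (i + 1)).1.deg
            aug := φ 0 (seq 0)
            diff := fun i => φ (i + 1) (seq (i + 1))
            aug_homogeneous := isHomogeneous_preserves_iff.2 (h1 0 (seq 0))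
            diff_homogeneous := fun i => isHomogeneous_preserves_iff.2 (h1 (i + 1) (seq (i + 1)))
            range_aug := h2 0 (seq 0)
            exact_zero := (h2 1 (seq 1)).trans (h5 0 (seq 0))
            exact_succ := fun i => (h2 (i + 2) (seq (i + 2))).trans (h5 (i + 1) (seq (i + 1)))
            minimal := fun i => ?_ }, fun k l => h4 k (seq k) l⟩
  exact ((h2 (i + 1) (seq (i + 1))).trans (h5 i (seq i))).trans_le (h3 i (seq i))

theorem isGraded_ker {d : Fin m → ℤ} {b : Fin r → ℤ}
    {φ : (Fin r → Poly K n) →ₗ[Poly K n] (Fin m → Poly K n)} (hφ : Preserves 1 b d φ) :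
    IsGraded b (LinearMap.ker φ) :=
  isGraded_iff.2 fun _ hg k => hφ.ker_mem hg k

theorem exists_minimalResolution {d : Fin m → ℤ} {N : Submodule (Poly K n) (Fin m → Poly K n)}
    (hN : IsGraded d N) : Nonempty (MinimalResolution d N) := by
  obtain ⟨P, -⟩ := exists_minimalResolution_of_step (fun _ S => IsGraded S.deg S.carrier)
    (fun _ _ => True) (fun k S hS => by
      obtain ⟨r, g, hgB, hg, hker⟩ := exists_minimal_generators (d := S.deg)
        (B := {f | f ∈ S.carrier ∧ ∃ k, IsHomogeneous S.deg k f})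
        (fun f hf => hf.2.imp fun k hk => isHomogeneous_iff.1 hk)
      choose b hb using fun l => (hgB l).2
      have hpres := preserves_linearCombination (c := 1) fun l => isHomogeneous_iff.1 (hb l)
      exact ⟨r, b, _, hpres, hg.trans hS, hker, fun _ => trivial, isGraded_ker hpres⟩) d N hN
  exact ⟨P⟩

/-- The ranks of a minimal resolution of a retract are bounded by those of a resolution. -/
theorem MinimalResolution.rank_le {m₁ : ℕ} {d₁ : Fin m₁ → ℤ} {d : Fin m → ℤ}
    {N₁ : Submodule (Poly K n) (Fin m₁ → Poly K n)} {N : Submodule (Poly K n) (Fin m → Poly K n)}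
    {σ : (Fin m₁ → Poly K n) →ₗ[Poly K n] (Fin m → Poly K n)} (hσ : Preserves 1 d₁ d σ)
    {π : (Fin m → Poly K n) →ₗ[Poly K n] (Fin m₁ → Poly K n)} (hπ : Preserves 1 d d₁ π)
    (hπσ : ∀ x, π (σ x) = x) (hσN : ∀ x ∈ N₁, σ x ∈ N) (hπN : ∀ x ∈ N, π x ∈ N₁)
    (P : MinimalResolution d₁ N₁) (Q : MinimalResolution d N) (i : ℕ) : P.rank i ≤ Q.rank i := by
  induction i generalizing m₁ m with
  | zero =>
    obtain ⟨σ', π', -, -, h, -⟩ := exists_retraction_lift hσ hπ hπσ P.preserves_aug P.ker_aug_le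
      Q.preserves_aug (by rwa [P.range_aug, Q.range_aug]) (by rwa [P.range_aug, Q.range_aug])
    exact rank_le_of_retraction h
  | succ i ih =>
    obtain ⟨σ', π', hσ', hπ', h, h1, h2⟩ := exists_retraction_lift hσ hπ hπσ P.preserves_aug
      P.ker_aug_le Q.preserves_aug (by rwa [P.range_aug, Q.range_aug])
      (by rwa [P.range_aug, Q.range_aug])
    refine ih hσ' hπ' h (fun x hx => ?_) (fun x hx => ?_) P.shift Q.shift
    · rw [LinearMap.mem_ker, h1, LinearMap.mem_ker.1 hx, map_zero]
    · rw [LinearMap.mem_ker, h2, LinearMap.mem_ker.1 hx, map_zero]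

theorem preserves_id (c : Fin n → ℕ) (e : Fin m → ℤ) :
    Preserves c e e (LinearMap.id : (Fin m → Poly K n) →ₗ[Poly K n] _) := fun _ _ => rfl

theorem MinimalResolution.rank_eq {d : Fin m → ℤ} {N : Submodule (Poly K n) (Fin m → Poly K n)}
    (P Q : MinimalResolution d N) (i : ℕ) : P.rank i = Q.rank i :=
  le_antisymm
    (rank_le (preserves_id 1 d) (preserves_id 1 d) (fun _ => rfl) (fun _ h => h) (fun _ h => h) P Q i)
    (rank_le (preserves_id 1 d) (preserves_id 1 d) (fun _ => rfl) (fun _ h => h) (fun _ h => h) Q P i)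

/-- The identity is a retraction in both directions between any two minimal resolutions, so the
infimum runs over a single value. -/
theorem betti_eq_rank {d : Fin m → ℤ} {N : Submodule (Poly K n) (Fin m → Poly K n)}
    (P : MinimalResolution d N) (i : ℕ) : betti d N i = P.rank i := by
  have : {b | ∃ P : MinimalResolution d N, P.rank i = b} = {P.rank i} := by
    ext b
    constructor
    · rintro ⟨Q, rfl⟩
      exact Q.rank_eq P i
    · rintro rfl
      exact ⟨P, rfl⟩
  rw [betti, this, csInf_singleton]

/-- Induction on the homological degree along 0 → Ω_0 → F_0 → N → 0: F_0 has no Koszul homology in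
the relevant range, and the shifted resolution satisfies the bound with r + 1. -/
theorem koszulRegular_of_minimalResolution {d : Fin m → ℤ}
    {N : Submodule (Poly K n) (Fin m → Poly K n)} {r : ℤ} (P : MinimalResolution d N)
    (h : ∀ i l, P.deg i l ≤ r + i) (i : ℕ) : KoszulRegular K n (piece d N) i r := by
  have hd : ∀ l, P.deg 0 l ≤ r := by simpa using h 0
  have hreg : ∀ i, KoszulRegular K n (piece (P.deg 0) ⊤) i r := fun i =>
    (koszulRegular_freePiece (P.deg 0) r i).congr fun q _ => (piece_top_eq hd q).symm
  have hGN : ∀ q, r ≤ q → ∀ g ∈ piece (P.deg 0) ⊤ q, P.aug g ∈ piece d N q := fun q _ g hg =>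
    ⟨P.range_aug.le ⟨g, rfl⟩, P.preserves_aug.map_eq hg.2⟩
  have hNG : ∀ q, r ≤ q → ∀ f ∈ piece d N q, ∃ g ∈ piece (P.deg 0) ⊤ q, P.aug g = f :=
    fun q _ f hf => by
      obtain ⟨g, hg, hg'⟩ := exists_graded_preimage P.preserves_aug (P.range_aug.ge hf.1) hf.2
      exact ⟨g, ⟨trivial, hg⟩, hg'⟩
  induction i generalizing m r with
  | zero =>
    rw [koszulRegular_zero_iff]
    intro q hq f hf
    obtain ⟨g, hg, rfl⟩ := hNG q hq.le f hf
    obtain ⟨y, hy, hy'⟩ := koszulRegular_zero_iff.1 (hreg 0) q hq g hg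
    refine ⟨fun j => P.aug (y j), fun j => hGN _ (by lia) _ (hy j), ?_⟩
    rw [hy', map_sum]
    simp only [map_smul]
  | succ i ih =>
    refine KoszulRegular.quotient P.aug hGN hNG
      (Z := piece (P.deg 0) (LinearMap.ker P.aug)) (fun q _ g => ?_)
      (fun q g hg j => X_smul_mem_piece hg j) (hreg _) ?_
    · rw [mem_piece, mem_piece, LinearMap.mem_ker]
      exact ⟨fun h => ⟨⟨trivial, h.2⟩, h.1⟩, fun h => ⟨h.2, h.1.2⟩⟩
    · have h1 : ∀ i l, P.shift.deg i l ≤ r + 1 + i := fun i l => by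
        have := h (i + 1) l
        push_cast at this
        exact this.trans (by lia)
      have h1' : ∀ l, P.shift.deg 0 l ≤ r + 1 := by simpa using h1 0
      refine ih P.shift h1 h1' (fun i => (koszulRegular_freePiece (P.shift.deg 0) (r + 1) i).congr
        fun q _ => (piece_top_eq h1' q).symm) (fun q _ g hg => ?_) (fun q _ f hf => ?_)
      · exact ⟨P.shift.range_aug.le ⟨g, rfl⟩, P.shift.preserves_aug.map_eq hg.2⟩
      · obtain ⟨g, hg, hg'⟩ := exists_graded_preimage P.shift.preserves_aug
          (P.shift.range_aug.ge hf.1) hf.2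
        exact ⟨g, ⟨trivial, hg⟩, hg'⟩

/-- A graded submodule whose homogeneous elements of large degree come from smaller degrees is
generated in small degrees. -/
theorem span_piece_le_eq {d : Fin m → ℤ} {N : Submodule (Poly K n) (Fin m → Poly K n)} {r : ℤ}
    (hN : IsGraded d N) (h : KoszulRegular K n (piece d N) 0 r) :
    Submodule.span (Poly K n) {f | ∃ k ≤ r, f ∈ piece d N k} = N := by
  refine le_antisymm (Submodule.span_le.2 fun f ⟨k, _, hf⟩ => hf.1) fun f hf => ?_
  refine mem_of_wcomp_mem (c := 1) (e := d) fun q => ?_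
  have key : ∀ q, r ≤ q → ∀ f ∈ piece d N q,
      f ∈ Submodule.span (Poly K n) {f | ∃ k ≤ r, f ∈ piece d N k} := by
    intro q hq
    induction q, hq using Int.leInduction with
    | base => exact fun f hf => Submodule.subset_span ⟨r, le_rfl, hf⟩
    | succ q hq ih =>
      intro f hf
      obtain ⟨g, hg, rfl⟩ := koszulRegular_zero_iff.1 h (q + 1) (by lia) f hf
      rw [add_sub_cancel_right] at hg
      exact Submodule.sum_mem _ fun j _ => Submodule.smul_mem _ _ (ih _ (hg j))
  rcases le_total q r with hq | hq
  · exact Submodule.subset_span ⟨q, hq, wcomp_mem_piece hN hf q⟩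
  · exact key q hq _ (wcomp_mem_piece hN hf q)

/-- Vanishing in homological degree zero allows generators of degree at most r, and the kernel of
the resulting cover satisfies the hypothesis with r + 1. Iterating this step builds the resolution.
-/
theorem regularityLE_of_koszulRegular {d : Fin m → ℤ}
    {N : Submodule (Poly K n) (Fin m → Poly K n)} {r : ℤ} (hN : IsGraded d N)
    (h : ∀ i, KoszulRegular K n (piece d N) i r) : RegularityLE d N r := by
  refine exists_minimalResolution_of_step (fun k S => IsGraded S.deg S.carrier ∧
    ∀ i, KoszulRegular K n (piece S.deg S.carrier) i (r + k)) (fun k a => a ≤ r + k) ?_ d N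
    ⟨hN, by simpa using h⟩
  rintro k S ⟨hS, hreg⟩
  obtain ⟨t, g, hgB, hg, hker⟩ := exists_minimal_generators (d := S.deg)
    (B := {f | ∃ a ≤ r + k, f ∈ piece S.deg S.carrier a}) (fun f ⟨a, _, hf⟩ => ⟨a, hf.2⟩)
  rw [span_piece_le_eq hS (hreg 0)] at hg
  choose b hb hgb using hgB
  have hpres := preserves_linearCombination (c := 1) fun l => (hgb l).2
  refine ⟨t, b, _, hpres, hg, hker, hb, isGraded_ker hpres, fun i => ?_⟩
  rw [Nat.cast_add, Nat.cast_one, ← add_assoc]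
  refine KoszulRegular.kernel (Fintype.linearCombination (Poly K n) g) (G := piece b ⊤)
    (N := piece S.deg S.carrier) (fun q _ y hy => ⟨hg.le ⟨y, rfl⟩, hpres.map_eq hy.2⟩)
    (fun q _ f hf => ?_) (fun q _ y => ?_) (fun q y hy j => X_smul_mem_piece hy j)
    ((koszulRegular_freePiece b (r + k) i).congr fun q _ => (piece_top_eq hb q).symm)
    (hreg (i + 1))
  · obtain ⟨y, hy, hy'⟩ := exists_graded_preimage hpres (hg.ge hf.1) hf.2
    exact ⟨y, ⟨trivial, hy⟩, hy'⟩
  · rw [mem_piece, mem_piece, LinearMap.mem_ker]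
    exact ⟨fun h => ⟨⟨trivial, h.2⟩, h.1⟩, fun h => ⟨h.2, h.1.2⟩⟩

theorem componentwiseLinear_iff {d : Fin m → ℤ} {N : Submodule (Poly K n) (Fin m → Poly K n)} :
    ComponentwiseLinear d N ↔ ∀ a i, KoszulRegular K n (piece d (component d a N)) i a := by
  unfold ComponentwiseLinear ComponentwiseRegular
  simp only [add_zero]
  refine forall_congr' fun a => ⟨?_, fun h => regularityLE_of_koszulRegular (isGraded_component d a N) h⟩
  rintro ⟨P, hP⟩ i
  exact koszulRegular_of_minimalResolution P hP i

theorem map_component {m₁ : ℕ} {d₁ : Fin m₁ → ℤ} {d : Fin m → ℤ}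
    {N₁ : Submodule (Poly K n) (Fin m₁ → Poly K n)} {N : Submodule (Poly K n) (Fin m → Poly K n)}
    {σ : (Fin m₁ → Poly K n) →ₗ[Poly K n] (Fin m → Poly K n)} (hσ : Preserves 1 d₁ d σ)
    (hσN : ∀ x ∈ N₁, σ x ∈ N) (a q : ℤ) {f : Fin m₁ → Poly K n}
    (hf : f ∈ piece d₁ (component d₁ a N₁) q) : σ f ∈ piece d (component d a N) q := by
  refine ⟨?_, hσ.map_eq hf.2⟩
  have hle : component d₁ a N₁ ≤ (component d a N).comap σ := by
    rw [component_eq_span, component_eq_span]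
    exact Submodule.span_le.2 fun x hx => Submodule.subset_span ⟨hσN x hx.1, hσ.map_eq hx.2⟩
  exact hle hf.1

/-- Graded maps restrict to the components N_{⟨a⟩}, and Koszul homology of a retract is a retract.
-/
theorem ComponentwiseLinear.retract {m₁ : ℕ} {d₁ : Fin m₁ → ℤ} {d : Fin m → ℤ}
    {N₁ : Submodule (Poly K n) (Fin m₁ → Poly K n)} {N : Submodule (Poly K n) (Fin m → Poly K n)}
    {σ : (Fin m₁ → Poly K n) →ₗ[Poly K n] (Fin m → Poly K n)} (hσ : Preserves 1 d₁ d σ)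
    {π : (Fin m → Poly K n) →ₗ[Poly K n] (Fin m₁ → Poly K n)} (hπ : Preserves 1 d d₁ π)
    (hπσ : ∀ x, π (σ x) = x) (hσN : ∀ x ∈ N₁, σ x ∈ N) (hπN : ∀ x ∈ N, π x ∈ N₁)
    (h : ComponentwiseLinear d N) : ComponentwiseLinear d₁ N₁ := by
  rw [componentwiseLinear_iff] at h ⊢
  exact fun a i => (h a i).retract σ π hπσ (fun q f => map_component hσ hσN a q)
    (fun q f => map_component hπ hπN a q)

/-- The kernel of a minimal free cover of a componentwise linear module is componentwise linear. -/
theorem ComponentwiseLinear.ker {d : Fin m → ℤ} {N : Submodule (Poly K n) (Fin m → Poly K n)}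
    (h : ComponentwiseLinear d N) {b : Fin r → ℤ}
    {φ : (Fin r → Poly K n) →ₗ[Poly K n] (Fin m → Poly K n)} (hφ : Preserves 1 b d φ)
    (hrange : LinearMap.range φ = N) (hker : LinearMap.ker φ ≤ maxIdeal K n • ⊤) :
    ComponentwiseLinear b (LinearMap.ker φ) := by
  rw [componentwiseLinear_iff] at h ⊢
  intro a
  -- From degree `a - 1` on, the part `G` of the free module on basis elements of degree at most `a
  -- - 1` maps onto N_{⟨a-1⟩}. The kernel `U` of this map inherits regularity `a`, and from degree
  -- `a` on it coincides with Z_{⟨a⟩}.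
  set Z := LinearMap.ker φ with hZdef
  set G := freePiece K n b (a - 1) with hG
  set W := component d (a - 1) N with hW
  have hGN : ∀ q, a - 1 ≤ q → ∀ g ∈ G q, φ g ∈ piece d W q := by
    intro q hq
    induction q, hq using Int.leInduction with
    | base =>
      intro g hg
      rw [piece_component_self]
      exact ⟨hrange.le ⟨g, rfl⟩, hφ.map_eq hg.1⟩
    | succ q hq ih =>
      intro g hg
      rw [← sum_X_smul_contractFree (coeff_zero_of_mem_freePiece (by lia) hg), map_sum]
      refine AddSubgroup.sum_mem _ fun k _ => ?_
      rw [map_smul]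
      refine X_smul_mem_piece (ih _ ?_) k
      simpa using contractFree_mem_freePiece hg k
  have hNG : ∀ q, a - 1 ≤ q → ∀ f ∈ piece d W q, ∃ g ∈ G q, φ g = f := by
    intro q hq
    induction q, hq using Int.leInduction with
    | base =>
      intro f hf
      rw [piece_component_self] at hf
      obtain ⟨g, hg, hg'⟩ := exists_graded_preimage hφ (hrange.ge hf.1) hf.2
      refine ⟨g, ⟨hg, fun l hl => ?_⟩, hg'⟩
      ext u
      rw [← hg, coeff_wcomp, if_neg, coeff_zero]
      rw [wt]
      lia
    | succ q hq ih =>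
      intro f hf
      obtain ⟨g, hg, rfl⟩ := exists_sum_X_smul_component hq hf
      choose y hy hy' using fun i => ih _ (hg i)
      refine ⟨∑ i, (X i : Poly K n) • y i,
        AddSubgroup.sum_mem _ fun i _ => X_smul_mem_freePiece (hy i) i, ?_⟩
      simp only [map_sum, map_smul, hy']
  let U : ℤ → AddSubgroup (Fin r → Poly K n) := fun q => piece b Z q ⊓ G q
  have hU : ∀ q, a - 1 < q → ∀ g, g ∈ U q ↔ g ∈ G q ∧ φ g = 0 := fun q _ g =>
    ⟨fun hg => ⟨hg.2, LinearMap.mem_ker.1 hg.1.1⟩, fun hg => ⟨⟨hg.2, hg.1.1⟩, hg.1⟩⟩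
  have hreg : ∀ i, KoszulRegular K n U i a := fun i => by
    have := KoszulRegular.kernel φ hGN hNG hU (fun q g hg j => X_smul_mem_freePiece hg j)
      (koszulRegular_freePiece b (a - 1) i) (h (a - 1) (i + 1))
    rwa [sub_add_cancel] at this
  have heq : ∀ q, a ≤ q → U q = piece b (component b a Z) q := by
    intro q hq
    induction q, hq using Int.leInduction with
    | base =>
      rw [piece_component_self]
      -- By minimality a syzygy of degree `a` has coefficients in the maximal ideal, hence involves
      -- only basis elements of degree at most `a - 1`.
      refine le_antisymm inf_le_left fun g hg => ⟨hg, ?_⟩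
      rw [← sum_X_smul_contractFree (mem_maxIdeal_smul_top_iff.1 (hker hg.1))]
      refine AddSubgroup.sum_mem _ fun k _ => ?_
      have h1 := contractFree_eq hg.2 k
      have h2 : contractFree k g ∈ G (a - 1) := by
        refine ⟨h1, fun l hl => ?_⟩
        ext u
        rw [← h1, coeff_wcomp, if_neg, coeff_zero]
        rw [wt]
        lia
      simpa using X_smul_mem_freePiece h2 k
    | succ q hq ih =>
      refine le_antisymm (fun g hg => ?_) fun g hg => ?_
      · obtain ⟨y, hy, rfl⟩ := koszulRegular_zero_iff.1 (hreg 0) (q + 1) (by lia) g hg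
        rw [add_sub_cancel_right, ih] at hy
        exact AddSubgroup.sum_mem _ fun k _ => X_smul_mem_piece (hy k) k
      · obtain ⟨y, hy, rfl⟩ := exists_sum_X_smul_component hq hg
        rw [← ih] at hy
        exact AddSubgroup.sum_mem _ fun k _ =>
          ⟨X_smul_mem_piece (hy k).1 k, X_smul_mem_freePiece (hy k).2 k⟩
  exact fun i => (hreg i).congr heq

end Resolutions

/-! ### Passage from the initial module back to the module. -/

section Degeneration

variable {K : Type*} [Field K] {n m : ℕ}

/-- The weight of a product of variables. -/
def setWeight (ω : Fin n → ℕ) (S : Finset (Fin n)) : ℤ := ∑ s ∈ S, (ω s : ℤ)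

theorem setWeight_insert (ω : Fin n → ℕ) {j : Fin n} {S : Finset (Fin n)} (hj : j ∉ S) :
    setWeight ω (insert j S) = ω j + setWeight ω S := Finset.sum_insert hj

/-- The component of weight `w` of a Koszul chain. -/
noncomputable def chainComp (ω : Fin n → ℕ) (e : Fin m → ℤ) (w : ℤ)
    (z : Finset (Fin n) → Fin m → Poly K n) (S : Finset (Fin n)) : Fin m → Poly K n :=
  wcomp ω e (w - setWeight ω S) (z S)

/-- Giving e_S the weight of the product of its variables makes the Koszul differential homogeneous
for the weight. -/
theorem koszulD_chainComp (ω : Fin n → ℕ) (e : Fin m → ℤ) (w : ℤ)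
    (z : Finset (Fin n) → Fin m → Poly K n) :
    koszulD K (chainComp ω e w z) = chainComp ω e w (koszulD K z) := by
  funext S
  simp only [koszulD, chainComp, map_sum, map_zsmul]
  refine Finset.sum_congr rfl fun j hj => ?_
  rw [wcomp_X_smul, setWeight_insert ω (Finset.mem_compl.1 hj)]
  congr 4
  ring

theorem weightLE_koszulD {ω : Fin n → ℕ} {e : Fin m → ℤ} {w : ℤ}
    {z : Finset (Fin n) → Fin m → Poly K n} (hz : ∀ S, WeightLE ω e (w - setWeight ω S) (z S))
    (S : Finset (Fin n)) : WeightLE ω e (w - setWeight ω S) (koszulD K z S) := by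
  refine WeightLE.sum fun j hj => WeightLE.zsmul ?_ _
  refine ((hz _).X_smul j).mono ?_
  rw [setWeight_insert ω (Finset.mem_compl.1 hj)]
  lia

/-- If the leading forms of `U` and `U'` are given by `I` and `I'`, and the cycles in `I` are
boundaries from `I'`, then a chain in `U` can be modified by a boundary from `U'` until its weight
is that of its differential. -/
theorem exists_weightLE_sub_koszulD {ω : Fin n → ℕ} {e : Fin m → ℤ}
    {U U' I I' : AddSubgroup (Fin m → Poly K n)} {i : ℕ}
    (hU : ∀ f ∈ U, ∀ w, WeightLE ω e w f → wcomp ω e w f ∈ I)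
    (hI' : ∀ f ∈ I', ∀ w, ∃ g ∈ U', WeightLE ω e (w - 1) (g - wcomp ω e w f))
    (hX : ∀ f ∈ U', ∀ j, (X j : Poly K n) • f ∈ U)
    (hex : ∀ z : Finset (Fin n) → Fin m → Poly K n, IsChain I i z →
      koszulD K z = 0 → ∃ h, IsChain I' (i + 1) h ∧ koszulD K h = z)
    {z : Finset (Fin n) → Fin m → Poly K n} (hz : IsChain U i z) {v : ℤ}
    (hv : ∀ S, WeightLE ω e (v - setWeight ω S) (koszulD K z S)) :
    ∃ h : Finset (Fin n) → Fin m → Poly K n, IsChain U' (i + 1) h ∧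
      ∀ S, WeightLE ω e (v - setWeight ω S) ((z - koszulD K h) S) := by
  -- `t` bounds the excess of the weight of `z` over `v`; each round lowers it by one.
  have key : ∀ (t : ℕ) (z : Finset (Fin n) → Fin m → Poly K n), IsChain U i z →
      (∀ S, WeightLE ω e (v - setWeight ω S) (koszulD K z S)) →
      (∀ S, WeightLE ω e (v + t - setWeight ω S) (z S)) →
      ∃ h : Finset (Fin n) → Fin m → Poly K n, IsChain U' (i + 1) h ∧
        ∀ S, WeightLE ω e (v - setWeight ω S) ((z - koszulD K h) S) := by
    intro t
    induction t with
    | zero =>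
      intro z hz _ hzw
      refine ⟨0, IsChain.zero, fun S => ?_⟩
      rw [koszulD_zero, sub_zero]
      simpa using hzw S
    | succ t ih =>
      intro z hz hv hzw
      set w : ℤ := v + (t + 1 : ℕ) with hw
      have hyI : IsChain I i (chainComp ω e w z) := fun S =>
        ⟨hU _ (hz S).1 _ (hzw S), fun h => by rw [chainComp, (hz S).2 h, map_zero]⟩
      -- The weight `w` exceeds `v`, so the differential of `z` has no component there and the
      -- leading part of `z` is a cycle.
      have hdy : koszulD K (chainComp ω e w z) = 0 := by
        rw [koszulD_chainComp]
        exact funext fun S => hv S _ (by lia)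
      obtain ⟨h₀, hh₀, hdh₀⟩ := hex _ hyI hdy
      obtain ⟨h₁, hh₁, hlead⟩ := hh₀.lift (V := U')
        (R := fun S f g => WeightLE ω e (w - setWeight ω S - 1)
          (g - wcomp ω e (w - setWeight ω S) f)) (fun S f hf => hI' f hf _)
        (fun S => by rw [map_zero, sub_zero]; exact WeightLE.zero)
      have hd₀ : koszulD K (chainComp ω e w h₀) = chainComp ω e w z := by
        rw [koszulD_chainComp, hdh₀]
        exact funext fun S => wcomp_self _ _ _ _
      have hz' : IsChain U i (z - koszulD K h₁) := hz.sub (hh₁.koszulD hX)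
      obtain ⟨h₂, hh₂, hfin⟩ := ih (z - koszulD K h₁) hz'
        (by rw [koszulD_sub, koszulD_koszulD, sub_zero]; exact hv) (fun S => by
          have h1 : WeightLE ω e (v + t - setWeight ω S) (z S - chainComp ω e w z S) :=
            ((hzw S).sub_wcomp).mono (by lia)
          have h2 : WeightLE ω e (v + t - setWeight ω S)
              (koszulD K (h₁ - chainComp ω e w h₀) S) :=
            weightLE_koszulD (fun S => (hlead S).mono (by lia)) S
          have h3 := h1.sub h2
          rw [koszulD_sub, hd₀, Pi.sub_apply, sub_sub_sub_cancel_right] at h3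
          exact h3)
      refine ⟨h₁ + h₂, hh₁.add hh₂, fun S => ?_⟩
      rw [koszulD_add, ← sub_sub]
      exact hfin S
  obtain ⟨t, ht⟩ : ∃ t : ℕ, ∀ S, WeightLE ω e (v + t - setWeight ω S) (z S) := by
    choose w hw using fun S => exists_weightLE ω e (z S)
    obtain ⟨B, hB⟩ := (Set.finite_range fun S => w S + setWeight ω S).bddAbove
    refine ⟨(B - v).toNat, fun S => (hw S).mono ?_⟩
    have := hB ⟨S, rfl⟩
    dsimp only at this
    lia
  exact key t z hz hv ht

/-- A module is componentwise linear if its initial module is, and if passing to the initial module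
commutes with multiplication by the maximal ideal. -/
theorem ComponentwiseLinear.of_initialModule {ω : Fin n → ℕ} {d : Fin m → ℤ} {ε : Fin m → ℕ}
    {N : Submodule (Poly K n) (Fin m → Poly K n)} (hN : IsGraded d N)
    (hlin : ComponentwiseLinear d (initialModule ω ε N))
    (hmul : ∀ q (g : Fin n → Fin m → Poly K n), (∀ i, g i ∈ piece d N q) → ∀ w,
      WeightLE ω (intWeight ε) w (∑ i, (X i : Poly K n) • g i) →
      ∃ y : Fin n → Fin m → Poly K n, (∀ i, y i ∈ piece d (initialModule ω ε N) q) ∧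
        wcomp ω (intWeight ε) w (∑ i, (X i : Poly K n) • g i) = ∑ i, (X i : Poly K n) • y i) :
    ComponentwiseLinear d N := by
  rw [componentwiseLinear_iff] at hlin ⊢
  intro a
  set e := intWeight ε with he
  set W := component d a N with hW
  set L := component d a (initialModule ω ε N) with hL
  -- `hsub` and `hsup` together identify the leading forms of N_{⟨a⟩} with in(N)_{⟨a⟩} from degree
  -- `a` on. This half only multiplies lifts by variables.
  have hsub : ∀ q, a ≤ q → ∀ f ∈ piece d L q, ∀ w, ∃ g ∈ piece d W q,
      WeightLE ω e (w - 1) (g - wcomp ω e w f) := by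
    intro q hq
    induction q, hq using Int.leInduction with
    | base =>
      intro f hf w
      rw [piece_component_self] at hf ⊢
      obtain ⟨g, hg, hg'⟩ := exists_piece_of_initialModule hN hf.1 a w
      rw [hf.2] at hg'
      exact ⟨g, hg, hg'⟩
    | succ q hq ih =>
      intro f hf w
      obtain ⟨y, hy, rfl⟩ := exists_sum_X_smul_component hq hf
      choose g hg hg' using fun i => ih (y i) (hy i) (w - ω i)
      refine ⟨∑ i, (X i : Poly K n) • g i,
        AddSubgroup.sum_mem _ fun i _ => X_smul_mem_piece (hg i) i, ?_⟩
      rw [map_sum, ← Finset.sum_sub_distrib]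
      refine WeightLE.sum fun i _ => ?_
      rw [wcomp_X_smul, ← smul_sub]
      exact ((hg' i).X_smul i).mono (by lia)
  -- Degree a + 1 is a second base case, settled by `hmul`: it involves 1-cycles with coefficients
  -- of degree `a`, about which linearity says nothing. From degree a + 2 on, first Koszul homology
  -- vanishes where it is needed.
  have hsup : ∀ q, a ≤ q → (∀ f ∈ piece d W q, ∀ w, WeightLE ω e w f →
      wcomp ω e w f ∈ piece d L q) ∧ (∀ f ∈ piece d W (q + 1), ∀ w, WeightLE ω e w f →
      wcomp ω e w f ∈ piece d L (q + 1)) := by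
    intro q hq
    induction q, hq using Int.leInduction with
    | base =>
      constructor
      · intro f hf w hw
        rw [piece_component_self] at hf ⊢
        exact ⟨wcomp_mem_initialModule hf.1 hw, by rw [wcomp_wcomp, hf.2]⟩
      · intro f hf w hw
        obtain ⟨g, hg, rfl⟩ := exists_sum_X_smul_component le_rfl hf
        rw [piece_component_self] at hg
        obtain ⟨y, hy, hy'⟩ := hmul a g hg w hw
        rw [hy']
        rw [← piece_component_self d a] at hy
        exact AddSubgroup.sum_mem _ fun i _ => X_smul_mem_piece (hy i) i
    | succ q hq ih =>
      refine ⟨ih.2, fun f hf w hw => ?_⟩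
      obtain ⟨g, hg, rfl⟩ := exists_sum_X_smul_component (by lia) hf
      have hchain := isChain_chainOne hg
      -- Subtracting a boundary leaves the sum `∑ i, X i • g i` unchanged and removes cancellation:
      -- each new coefficient has weight at most `w - ω i`, so the component of weight `w` is
      -- computed termwise.
      obtain ⟨h, hh, hh'⟩ := exists_weightLE_sub_koszulD (ω := ω) (e := e) (v := w)
        (I := piece d L (q + 1)) (I' := piece d L q) (U' := piece d W q) ih.2 (hsub q hq)
        (fun f hf j => X_smul_mem_piece hf j)
        (fun z hz hdz => by
          have := hlin a 1 (q + 1) (by lia) z hz hdz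
          rwa [add_sub_cancel_right] at this) hchain (fun S => by
            by_cases hS : S = ∅
            · rw [hS, koszulD_chainOne]
              simpa [setWeight] using hw
            · rw [((hchain.koszulD (fun f hf j => X_smul_mem_piece hf j)) S).2 (by simpa using hS)]
              exact WeightLE.zero)
      have hg' : IsChain (piece d W (q + 1)) 1 (chainOne g - koszulD K h) :=
        hchain.sub (hh.koszulD fun f hf j => X_smul_mem_piece hf j)
      have hsum : ∑ i, (X i : Poly K n) • g i =
          ∑ i, (X i : Poly K n) • (chainOne g - koszulD K h) {i} := by
        rw [← koszulD_chainOne, ← koszulD_empty, koszulD_sub, koszulD_koszulD, sub_zero]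
      rw [hsum, map_sum]
      refine AddSubgroup.sum_mem _ fun i _ => ?_
      rw [wcomp_X_smul]
      refine X_smul_mem_piece (ih.2 _ (hg' {i}).1 _ ?_) i
      have := hh' {i}
      rwa [setWeight, Finset.sum_singleton] at this
  intro i q hq z hz hdz
  -- The differential of a cycle satisfies every weight bound, so `v = -1` is allowed; what remains
  -- has negative weight and is zero.
  obtain ⟨h, hh, hh'⟩ := exists_weightLE_sub_koszulD (ω := ω) (e := e) (v := -1)
    (I := piece d L q) (I' := piece d L (q - 1)) (U' := piece d W (q - 1))
    (hsup q hq.le).1 (hsub (q - 1) (by lia))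
    (fun f hf j => by simpa using X_smul_mem_piece hf j) (hlin a i q hq) hz
    (fun S => by rw [hdz]; exact WeightLE.zero)
  refine ⟨h, hh, ?_⟩
  rw [eq_comm, ← sub_eq_zero]
  funext S
  refine eq_zero_of_weightLE (b := 0) (fun j => Int.natCast_nonneg (ε j)) ?_ (hh' S)
  have : 0 ≤ setWeight ω S := Finset.sum_nonneg fun s _ => Int.natCast_nonneg _
  lia

/-- A free cover of a module by lifts of a minimal system of generators of its initial module. -/
structure LiftedCover (ω : Fin n → ℕ) (d : Fin m → ℤ) (ε : Fin m → ℕ)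
    (N : Submodule (Poly K n) (Fin m → Poly K n)) where
  /-- the number of generators -/
  rank : ℕ
  /-- the degrees of the generators -/
  deg : Fin rank → ℤ
  /-- the weights of the generators -/
  weight : Fin rank → ℕ
  /-- the cover of the module -/
  map : (Fin rank → Poly K n) →ₗ[Poly K n] (Fin m → Poly K n)
  /-- the cover of the initial module -/
  lead : (Fin rank → Poly K n) →ₗ[Poly K n] (Fin m → Poly K n)
  preserves_map : Preserves 1 deg d map
  preserves_lead : Preserves 1 deg d lead
  preserves_weight : Preserves ω (intWeight weight) (intWeight ε) lead
  range_lead : LinearMap.range lead = initialModule ω ε N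
  ker_lead : LinearMap.ker lead ≤ maxIdeal K n • ⊤
  weight_sub : ∀ {w g}, WeightLE ω (intWeight weight) w g →
    WeightLE ω (intWeight ε) (w - 1) (map g - lead g)
  map_mem : ∀ g, map g ∈ N

theorem exists_liftedCover (ω : Fin n → ℕ) {d : Fin m → ℤ} (ε : Fin m → ℕ)
    {N : Submodule (Poly K n) (Fin m → Poly K n)} (hN : IsGraded d N) :
    Nonempty (LiftedCover ω d ε N) := by
  set I := initialModule ω ε N with hI
  -- Natural weights suffice because components of negative weight vanish; they allow the kernel of
  -- the cover to be degenerated again with weights in ℕ.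
  let B : Set (Fin m → Poly K n) :=
    {f | f ∈ I ∧ ∃ (q : ℤ) (w : ℕ), wcomp 1 d q f = f ∧ wcomp ω (intWeight ε) w f = f}
  have hB : Submodule.span (Poly K n) B = I := by
    refine le_antisymm (Submodule.span_le.2 fun f hf => hf.1) fun f hf => ?_
    refine mem_of_wcomp_mem (c := 1) (e := d) fun q => ?_
    refine mem_of_wcomp_mem (c := ω) (e := intWeight ε) fun w => ?_
    by_cases hw : w < 0
    · rw [wcomp_eq_zero_of_lt (fun j => Int.natCast_nonneg (ε j)) hw]
      exact Submodule.zero_mem _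
    · obtain ⟨w, rfl⟩ := Int.eq_ofNat_of_zero_le (not_lt.1 hw)
      refine Submodule.subset_span ⟨initialModule_weight
        (isGraded_iff.1 (isGraded_initialModule hN) f hf q) _, q, w, ?_, wcomp_self _ _ _ _⟩
      rw [wcomp_wcomp, wcomp_self]
  obtain ⟨r, g, hgB, hg, hker⟩ := exists_minimal_generators (d := d) (B := B)
    (fun f hf => by obtain ⟨-, q, w, h, -⟩ := hf; exact ⟨q, h⟩)
  rw [hB] at hg
  choose hgI b δ hb hδ using hgB
  choose f hf hfg using fun l => exists_piece_of_initialModule hN (hgI l) (b l) (δ l)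
  have hfg' : ∀ l, WeightLE ω (intWeight ε) (δ l - 1) (f l - g l) := fun l => by
    have := hfg l
    rwa [hb, hδ] at this
  exact ⟨{ rank := r
           deg := b
           weight := δ
           map := Fintype.linearCombination (Poly K n) f
           lead := Fintype.linearCombination (Poly K n) g
           preserves_map := preserves_linearCombination fun l => (hf l).2
           preserves_lead := preserves_linearCombination hb
           preserves_weight := preserves_linearCombination hδ
           range_lead := hg
           ker_lead := hker
           weight_sub := fun {w y} hy => by
             rw [← LinearMap.sub_apply]
             refine weightLE_of_basis (fun l => ?_) hy
             rw [LinearMap.sub_apply, linearCombination_single, linearCombination_single]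
             exact hfg' l
           map_mem := fun y => by
             rw [Fintype.linearCombination_apply]
             exact N.sum_mem fun l _ => N.smul_mem _ (hf l).1 }⟩

namespace LiftedCover

variable {ω : Fin n → ℕ} {d : Fin m → ℤ} {ε : Fin m → ℕ}
  {N : Submodule (Poly K n) (Fin m → Poly K n)} (G : LiftedCover ω d ε N)

/-- Division by the lifted generators: the leading part of `f` is lifted through `lead`, its image
under `map` is subtracted, and the weight drops. The point is that the preimage obeys the same
weight bound as `f`. -/
theorem exists_preimage {f : Fin m → Poly K n} (hf : f ∈ N) {w : ℤ}
    (hw : WeightLE ω (intWeight ε) w f) :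
    ∃ g, WeightLE ω (intWeight G.weight) w g ∧ G.map g = f := by
  have key : ∀ (t : ℕ) (w : ℤ), w < t → ∀ f ∈ N, WeightLE ω (intWeight ε) w f →
      ∃ g, WeightLE ω (intWeight G.weight) w g ∧ G.map g = f := by
    intro t
    induction t with
    | zero =>
      intro w hw f _ hfw
      refine ⟨0, WeightLE.zero, ?_⟩
      rw [map_zero, eq_zero_of_weightLE (fun j => Int.natCast_nonneg (ε j)) (by simpa using hw) hfw]
    | succ t ih =>
      intro w hw f hf hfw
      obtain ⟨y, hy⟩ := G.range_lead.ge (wcomp_mem_initialModule hf hfw)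
      have hy' : G.lead (wcomp ω (intWeight G.weight) w y) = wcomp ω (intWeight ε) w f := by
        rw [G.preserves_weight, hy, wcomp_self]
      have hyw : WeightLE ω (intWeight G.weight) w (wcomp ω (intWeight G.weight) w y) :=
        WeightLE.of_wcomp (wcomp_self _ _ _ _)
      have h1 := hfw.sub_wcomp.sub (G.weight_sub hyw)
      rw [hy', sub_sub_sub_cancel_right] at h1
      obtain ⟨g, hg, hg'⟩ := ih (w - 1) (by push_cast at hw; lia) _ (N.sub_mem hf (G.map_mem _)) h1
      refine ⟨g + wcomp ω (intWeight G.weight) w y, (hg.mono (by lia)).add hyw, ?_⟩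
      rw [map_add, hg', sub_add_cancel]
  exact key (w + 1).toNat w (by lia) f hf hw

theorem range_map : LinearMap.range G.map = N := by
  refine le_antisymm ?_ fun f hf => ?_
  · rintro _ ⟨g, rfl⟩
    exact G.map_mem g
  · obtain ⟨w, hw⟩ := exists_weightLE ω (intWeight ε) f
    obtain ⟨g, -, hg⟩ := G.exists_preimage hf hw
    exact ⟨g, hg⟩

theorem wcomp_map {w : ℤ} {g : Fin G.rank → Poly K n}
    (hg : WeightLE ω (intWeight G.weight) w g) :
    wcomp ω (intWeight ε) w (G.map g) = G.lead (wcomp ω (intWeight G.weight) w g) := by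
  rw [(G.weight_sub hg).wcomp_eq, G.preserves_weight]

/-- The initial module of the syzygies is the module of syzygies of the initial module. -/
theorem initialModule_ker :
    initialModule ω G.weight (LinearMap.ker G.map) = LinearMap.ker G.lead := by
  ext g
  rw [mem_initialModule_iff]
  constructor
  · intro h
    rw [LinearMap.mem_ker]
    refine eq_zero_of_wcomp (c := ω) (e := intWeight ε) fun w => ?_
    obtain ⟨k, hk, hkw⟩ := h w
    have h1 : WeightLE ω (intWeight G.weight) w k := by
      have := (hkw.mono (by lia : w - 1 ≤ w)).add
        (WeightLE.of_wcomp (wcomp_self ω (intWeight G.weight) w g))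
      rwa [sub_add_cancel] at this
    rw [← G.preserves_weight, ← wcomp_self, ← hkw.wcomp_eq, ← G.wcomp_map h1,
      LinearMap.mem_ker.1 hk, map_zero]
  -- A syzygy of the leading forms is sent by `map` to an element of smaller weight, which has a
  -- preimage `y` of smaller weight. Subtracting `y` gives a syzygy of the lifts with the same
  -- leading part.
  · intro hg w
    have hgw : WeightLE ω (intWeight G.weight) w (wcomp ω (intWeight G.weight) w g) :=
      WeightLE.of_wcomp (wcomp_self _ _ _ _)
    have h1 := G.weight_sub hgw
    rw [G.preserves_weight, LinearMap.mem_ker.1 hg, map_zero, sub_zero] at h1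
    obtain ⟨y, hy, hy'⟩ := G.exists_preimage (G.map_mem _) h1
    refine ⟨wcomp ω (intWeight G.weight) w g - y, ?_, ?_⟩
    · rw [LinearMap.mem_ker, map_sub, hy', sub_self]
    · rw [sub_sub_cancel_left, ← zero_sub]
      exact WeightLE.zero.sub hy

/-- If the lifted cover is minimal, then the module is componentwise linear as soon as its initial
module is. -/
theorem componentwiseLinear (hN : IsGraded d N)
    (hlin : ComponentwiseLinear d (initialModule ω ε N))
    (hmin : LinearMap.ker G.map ≤ maxIdeal K n • ⊤) : ComponentwiseLinear d N := by
  refine ComponentwiseLinear.of_initialModule hN hlin fun q g hg w hw => ?_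
  set f := ∑ i, (X i : Poly K n) • g i with hf
  have hfN : f ∈ piece d N (q + 1) := AddSubgroup.sum_mem _ fun i _ => X_smul_mem_piece (hg i) i
  obtain ⟨y, hyw, hy⟩ := G.exists_preimage hfN.1 hw
  -- The element `f` has a second preimage of the form `∑ i, X i • x i`. The two differ by an
  -- element of the kernel, so minimality puts `y` in 𝔪G as well.
  have hy0 : ∀ l, coeff 0 (y l) = 0 := by
    choose x hx using fun i => G.range_map.ge (hg i).1
    have h1 : ∑ i, (X i : Poly K n) • x i - y ∈ LinearMap.ker G.map := by
      rw [LinearMap.mem_ker, map_sub, map_sum, hy, hf, sub_eq_zero]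
      simp only [map_smul, hx]
    have h2 : ∑ i, (X i : Poly K n) • x i ∈ maxIdeal K n •
        (⊤ : Submodule (Poly K n) (Fin G.rank → Poly K n)) :=
      Submodule.sum_mem _ fun i _ =>
        Submodule.smul_mem_smul (Ideal.subset_span ⟨i, rfl⟩) Submodule.mem_top
    have := Submodule.sub_mem _ h2 (hmin h1)
    rw [sub_sub_cancel] at this
    exact mem_maxIdeal_smul_top_iff.1 this
  set y' := wcomp 1 G.deg (q + 1) (wcomp ω (intWeight G.weight) w y) with hy'
  have hy'0 : ∀ l, coeff 0 (y' l) = 0 := fun l => by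
    rw [hy', coeff_wcomp, coeff_wcomp, hy0, ite_self, ite_self]
  have hlead : G.lead y' = wcomp ω (intWeight ε) w f := by
    rw [hy', G.preserves_lead, ← G.wcomp_map hyw, hy, wcomp_wcomp, hfN.2]
  refine ⟨fun i => G.lead (contractFree i y'), fun i => ⟨G.range_lead.le ⟨_, rfl⟩,
    G.preserves_lead.map_eq ?_⟩, ?_⟩
  · have := contractFree_eq (wcomp_self 1 G.deg (q + 1) (wcomp ω (intWeight G.weight) w y)) i
    rwa [add_sub_cancel_right] at this
  · rw [← hlead]
    conv_lhs => rw [← sum_X_smul_contractFree hy'0]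
    simp only [map_sum, map_smul]

theorem rank_eq_rank_zero (Q : MinimalResolution d (initialModule ω ε N)) : Q.rank 0 = G.rank := by
  obtain ⟨Q'⟩ := exists_minimalResolution (isGraded_ker G.preserves_lead)
  exact Q.rank_eq (Q'.cons G.preserves_lead G.range_lead G.ker_lead) 0

theorem rank_succ_eq (Q : MinimalResolution d (initialModule ω ε N))
    (Q' : MinimalResolution G.deg (initialModule ω G.weight (LinearMap.ker G.map))) (i : ℕ) :
    Q.rank (i + 1) = Q'.rank i := by
  have h := G.initialModule_ker
  generalize initialModule ω G.weight (LinearMap.ker G.map) = I at Q' h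
  subst h
  exact Q.rank_eq (Q'.cons G.preserves_lead G.range_lead G.ker_lead) (i + 1)

end LiftedCover

theorem map_mem_maxIdeal_smul_top {r s : ℕ}
    (σ : (Fin r → Poly K n) →ₗ[Poly K n] (Fin s → Poly K n)) {x : Fin r → Poly K n}
    (hx : x ∈ maxIdeal K n • (⊤ : Submodule (Poly K n) (Fin r → Poly K n))) :
    σ x ∈ maxIdeal K n • (⊤ : Submodule (Poly K n) (Fin s → Poly K n)) := by
  have h := Submodule.mem_map_of_mem (f := σ) hx
  rw [Submodule.map_smul''] at h
  exact Submodule.smul_mono le_rfl le_top h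

/-- The `k`-th syzygy module in a minimal resolution, starting from the module itself. -/
noncomputable abbrev MinimalResolution.syz {d : Fin m → ℤ}
    {N : Submodule (Poly K n) (Fin m → Poly K n)} (P : MinimalResolution d N) (k : ℕ) :
    SubmoduleOfFree K n := P.syzygy ((k : ℤ) - 1)

theorem MinimalResolution.syz_zero {d : Fin m → ℤ}
    {N : Submodule (Poly K n) (Fin m → Poly K n)} (P : MinimalResolution d N) :
    P.syz 0 = ⟨m, d, N⟩ := rfl

theorem MinimalResolution.syz_succ {d : Fin m → ℤ}
    {N : Submodule (Poly K n) (Fin m → Poly K n)} (P : MinimalResolution d N) (k : ℕ) :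
    P.syz (k + 1) = P.shift.syz k := by
  have h : ∀ k : ℕ, ((k + 1 : ℕ) : ℤ) - 1 = (k : ℕ) := fun k => by push_cast; ring
  rw [syz, h]
  cases k with
  | zero => rfl
  | succ k =>
    rw [syz, h]
    cases k <;> rfl

theorem ComponentwiseLinear.syz_succ {d : Fin m → ℤ}
    {N : Submodule (Poly K n) (Fin m → Poly K n)} (P : MinimalResolution d N) {k : ℕ}
    (h : ComponentwiseLinear (P.syz k).deg (P.syz k).carrier) :
    ComponentwiseLinear (P.syz (k + 1)).deg (P.syz (k + 1)).carrier := by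
  induction k generalizing m with
  | zero =>
    rw [P.syz_succ, P.shift.syz_zero]
    rw [P.syz_zero] at h
    exact h.ker P.preserves_aug P.range_aug P.ker_aug_le
  | succ k ih =>
    rw [P.syz_succ] at h ⊢
    exact ih P.shift h

/-- The claim concerns a retract N₁ of N because the syzygies in a minimal resolution are only
retracts of the kernels of lifted covers; in this form the induction closes. By truncated
subtraction, i = 0 and i = 1 both speak of N₁ itself. -/
theorem componentwiseLinear_syz_of_rank_eq {m₁ : ℕ} {d₁ : Fin m₁ → ℤ} {ω : Fin n → ℕ}
    {d : Fin m → ℤ} {ε : Fin m → ℕ}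
    {N₁ : Submodule (Poly K n) (Fin m₁ → Poly K n)} {N : Submodule (Poly K n) (Fin m → Poly K n)}
    (hN : IsGraded d N)
    {σ : (Fin m₁ → Poly K n) →ₗ[Poly K n] (Fin m → Poly K n)} (hσ : Preserves 1 d₁ d σ)
    {π : (Fin m → Poly K n) →ₗ[Poly K n] (Fin m₁ → Poly K n)} (hπ : Preserves 1 d d₁ π)
    (hπσ : ∀ x, π (σ x) = x) (hσN : ∀ x ∈ N₁, σ x ∈ N) (hπN : ∀ x ∈ N, π x ∈ N₁)
    (hlin : ComponentwiseLinear d (initialModule ω ε N))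
    (P : MinimalResolution d₁ N₁) (Q : MinimalResolution d (initialModule ω ε N)) (i : ℕ)
    (h : P.rank i = Q.rank i) :
    ComponentwiseLinear (P.syz (i - 1)).deg (P.syz (i - 1)).carrier := by
  induction i generalizing m₁ m with
  | zero =>
    obtain ⟨G⟩ := exists_liftedCover ω ε hN
    obtain ⟨σ', π', hσ', hπ', h', h1, h2⟩ := exists_retraction_lift hσ hπ hπσ P.preserves_aug
      P.ker_aug_le G.preserves_map (by rwa [P.range_aug, G.range_map])
      (by rwa [P.range_aug, G.range_map])
    have hr : P.rank 0 = G.rank := h.trans (G.rank_eq_rank_zero Q)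
    refine (G.componentwiseLinear hN hlin fun y hy => ?_).retract hσ hπ hπσ hσN hπN
    -- Equal ranks turn the retraction into an isomorphism, which carries the minimality of `P.aug`
    -- over to `G.map`.
    rw [← right_inverse_of_rank_eq hr h' y]
    have h3 : π' y ∈ LinearMap.ker P.aug := by
      rw [LinearMap.mem_ker, h2, LinearMap.mem_ker.1 hy, map_zero]
    exact map_mem_maxIdeal_smul_top σ' (P.ker_aug_le h3)
  | succ i ih =>
    obtain ⟨G⟩ := exists_liftedCover ω ε hN
    obtain ⟨σ', π', hσ', hπ', h', h1, h2⟩ := exists_retraction_lift hσ hπ hπσ P.preserves_aug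
      P.ker_aug_le G.preserves_map (by rwa [P.range_aug, G.range_map])
      (by rwa [P.range_aug, G.range_map])
    have hσ'N : ∀ x ∈ LinearMap.ker P.aug, σ' x ∈ LinearMap.ker G.map := fun x hx => by
      rw [LinearMap.mem_ker, h1, LinearMap.mem_ker.1 hx, map_zero]
    have hπ'N : ∀ x ∈ LinearMap.ker G.map, π' x ∈ LinearMap.ker P.aug := fun x hx => by
      rw [LinearMap.mem_ker, h2, LinearMap.mem_ker.1 hx, map_zero]
    have hN' := isGraded_ker G.preserves_map
    obtain ⟨Q'⟩ := exists_minimalResolution (isGraded_initialModule (ω := ω) (ε := G.weight) hN')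
    have hr : P.shift.rank i = Q'.rank i := h.trans (G.rank_succ_eq Q Q' i)
    cases i with
    | zero =>
      obtain ⟨G'⟩ := exists_liftedCover ω G.weight hN'
      obtain ⟨σ'', π'', -, -, h'', h3, -⟩ := exists_retraction_lift hσ' hπ' h'
        P.shift.preserves_aug P.shift.ker_aug_le G'.preserves_map
        (by rwa [P.shift.range_aug, G'.range_map]) (by rwa [P.shift.range_aug, G'.range_map])
      refine (G.componentwiseLinear hN hlin fun y hy => ?_).retract hσ hπ hπσ hσN hπN
      -- Equal ranks at the second stage identify the cover `G'` of the kernel with F_1, so every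
      -- element of the kernel is the image under `σ'` of an element of ∂_1(F_1) ⊆ 𝔪F_0. Hence `G`
      -- is minimal although its rank was not compared with that of F_0.
      obtain ⟨x, rfl⟩ := G'.range_map.ge hy
      rw [← right_inverse_of_rank_eq (hr.trans (G'.rank_eq_rank_zero Q')) h'' x, h3]
      exact map_mem_maxIdeal_smul_top σ' (P.minimal 0 ⟨_, rfl⟩)
    | succ i =>
      -- The initial module of `ker G.map` is the first syzygy module of in(N), so it is again
      -- componentwise linear and the induction applies to the kernels.
      have hlin' := hlin.ker G.preserves_lead G.range_lead G.ker_lead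
      rw [← G.initialModule_ker] at hlin'
      rw [Nat.add_sub_cancel, P.syz_succ]
      exact ih hN' hσ' hπ' h' hσ'N hπ'N hlin' P.shift Q' hr

end Degeneration

end GradedFree

theorem theorem5p6 {K : Type*} [Field K] {n m : ℕ}
    (ω : Fin n → ℕ) (d : Fin m → ℤ) (ε : Fin m → ℕ)
    (M : Submodule (MvPolynomial (Fin n) K) (Fin m → MvPolynomial (Fin n) K))
    (hM : GradedFree.IsGraded d M)
    (hlin : GradedFree.ComponentwiseLinear d (GradedFree.initialModule ω ε M))
    (i : ℕ)
    (hβ : GradedFree.betti d M i = GradedFree.betti d (GradedFree.initialModule ω ε M) i)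
    (P : GradedFree.MinimalResolution d M) (j : ℤ) (hj : (i : ℤ) - 2 ≤ j) :
    GradedFree.ComponentwiseLinear (P.syzygy j).deg (P.syzygy j).carrier := by
  obtain ⟨Q⟩ := GradedFree.exists_minimalResolution
    (GradedFree.isGraded_initialModule (ω := ω) (ε := ε) hM)
  rw [GradedFree.betti_eq_rank P, GradedFree.betti_eq_rank Q] at hβ
  have h := GradedFree.componentwiseLinear_syz_of_rank_eq hM (GradedFree.preserves_id 1 d)
    (GradedFree.preserves_id 1 d) (fun _ => rfl) (fun _ h => h) (fun _ h => h) hlin P Q i hβ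
  have hsyz : ∀ k, i - 1 ≤ k → GradedFree.ComponentwiseLinear (P.syz k).deg (P.syz k).carrier := by
    intro k hk
    induction k, hk using Nat.le_induction with
    | base => exact h
    | succ k _ ih => exact ih.syz_succ P
  by_cases hj' : -1 ≤ j
  · have hk := hsyz (j + 1).toNat (by lia)
    rwa [GradedFree.MinimalResolution.syz, Int.toNat_of_nonneg (by lia), add_sub_cancel_right] at hk
  · obtain ⟨k, rfl⟩ := Int.eq_negSucc_of_lt_zero (by lia : j < 0)
    exact hsyz 0 (by lia)
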